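/- **Setting.** Let $\mathbf B$ be the set of bonds (nearest-neighbour edges) of $\mathbb Z^2$, embedded in $\mathbb R^2$ as unit segments, and let $d\ge 1$. Let $\mathfrak A$ be the quasi-local $C^*$-algebra with a copy of $M_d(\mathbb C)$ at each bond; for $\Lambda\subset\mathbf B$ let $\mathfrak A(\Lambda)\subset\mathfrak A$ be the norm closure of $\bigcup_F \bigotimes_{b\in F} M_d(\mathbb C)$, the union being over all finite $F\subset\Lambda$. A *cone* is a set of the form $\Lambda=\{b\in\mathbf B : b \text{ without its endpoints meets } S\}$, where $S\subset\mathbb R^2$ is the closed region bounded by two half-lines from a common point with angle strictly between $0$ and $\pi$. Put $\Lambda^c=\mathbf B\setminus\Lambda$. Let $\pi_0$ be an irreducible (unital) $*$-representation of $\mathfrak A$ on a Hilbert space $\mathcal H$. For $\Lambda\subset\mathbf B$ put $\mathcal R(\Lambda)=\pi_0(\mathfrak A(\Lambda))''$ and $\widehat{\mathcal R}(\Lambda)=\mathcal R(\Lambda^c)'$. Assume * (Haag duality) $\mathcal R(\Lambda)=\mathcal R(\Lambda^c)'$ for every cone $\Lambda$; * (distal split property) $\ll$ is a relation on the set of cones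 such that $\Lambda_1\ll\Lambda_2$ implies that $\Lambda_1\subset\Lambda_2$ and that there is a Type I factor $\mathcal N$ with $\mathcal R(\Lambda_1)\subset\mathcal N\subset\mathcal R(\Lambda_2)$. Let $\mathcal C^2$ be the set of all unions $\Lambda_1\cup\Lambda_2$ of two cones for which there is a cone $\Lambda$ with $\Lambda_1\ll\Lambda$ and $\Lambda_2\subset\Lambda^c$. For von Neumann algebras $\mathcal N\subset\mathcal M$ on $\mathcal H$, the Kosaki-Longo index $[\mathcal M:\mathcal N]\in[0,\infty]$ is the infimum of $\lambda^{-1}$ over all $\lambda>0$ for which some normal conditional expectation $\mathcal E$ of $\mathcal M$ onto $\mathcal N$ satisfies $\mathcal E(X)\ge\lambda X$ for all $X\in\mathcal M_+$; it is $\infty$ if there is no such $\lambda$. **Proposition (index monotonicity).** Let $\Gamma=\Lambda_1\cup\Lambda_2$ and $\widehat\Gamma=\widehat\Lambda_1\cup\widehat\Lambda_2$ be elements of $\mathcal C^2$ with $\Gamma\subset\widehat\Gamma$ cone by cone: the two cones $\Lambda_1,\Lambda_2$ exhibit $\Gamma$, and the two cones $\widehat\Lambda_1,\widehat\Lambda_2$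 exhibit $\widehat\Gamma$, as an element of $\mathcal C^2$ (each pair taken in one of its two orders), and $\Lambda_1\subset\widehat\Lambda_1$, $\Lambda_2\subset\widehat\Lambda_2$. Then $$[\widehat{\mathcal R}(\Gamma):\mathcal R(\Gamma)]\;\le\;[\widehat{\mathcal R}(\widehat\Gamma):\mathcal R(\widehat\Gamma)].$$ -/

import Mathlib

open scoped ENNReal NNReal InnerProductSpace

noncomputable section

namespace SpinModel

/-! ### Bonds of the square lattice and cones -/

/-- The bonds (nearest-neighbour edges) of `ℤ²`: `((x, y), false)` is the horizontal bond from
`(x, y)` to `(x + 1, y)`, and `((x, y), true)` the vertical bond from `(x, y)` to `(x, y + 1)`. -/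
abbrev Bond : Type := (ℤ × ℤ) × Bool

/-- The first endpoint of a bond, as a point of the plane. -/
def Bond.source (b : Bond) : ℝ × ℝ := ((b.1.1 : ℝ), (b.1.2 : ℝ))

/-- The second endpoint of a bond, as a point of the plane. -/
def Bond.target (b : Bond) : ℝ × ℝ :=
  if b.2 then ((b.1.1 : ℝ), (b.1.2 : ℝ) + 1) else ((b.1.1 : ℝ) + 1, (b.1.2 : ℝ))

/-- A bond, embedded in the plane, with its endpoints removed. -/
def Bond.segment (b : Bond) : Set (ℝ × ℝ) := openSegment ℝ b.source b.target

/-- The closed planar region bounded by the two half-lines that start at `p` in the directions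
`u` and `v`. -/
def sector (p u v : ℝ × ℝ) : Set (ℝ × ℝ) :=
  {q | ∃ s t : ℝ, 0 ≤ s ∧ 0 ≤ t ∧ q = p + s • u + t • v}

/-- A cone is the set of all bonds which, with endpoints removed, meet a fixed planar sector whose
angle lies strictly between `0` and `π`, i.e. whose two directions are linearly independent. -/
def IsCone (Λ : Set Bond) : Prop :=
  ∃ p u v : ℝ × ℝ, LinearIndependent ℝ ![u, v] ∧ Λ = {b | (b.segment ∩ sector p u v).Nonempty}

/-! ### The quasi-local algebra

The algebra of the infinite tensor product `⨂_b M_d(ℂ)` is realised concretely. The matrix algebra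
at a bond `b` acts on `ℓ²(Bond → Fin d)` through the coordinate `b` of a configuration; algebras
at different bonds commute, so the algebra generated by those of a finite set `F` of bonds is
`⨂_{b ∈ F} M_d(ℂ)`, included in those of larger sets by tensoring with identity matrices. -/

/-- The Hilbert space `ℓ²` over all spin configurations. -/
abbrev ConfigSpace (d : ℕ) : Type := lp (fun _ : Bond → Fin d => ℂ) 2

variable {d : ℕ}

theorem unitFun_sum_le (b : Bond) (i j : Fin d) (ψ : ConfigSpace d)
    (S : Finset (Bond → Fin d)) :
    ∑ s ∈ S, ‖(if s b = i then ψ (Function.update s b j) else 0 : ℂ)‖ ^ (2 : ℝ≥0∞).toReal ≤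
      ‖ψ‖ ^ (2 : ℝ≥0∞).toReal := by
  classical
  have hp : 0 < (2 : ℝ≥0∞).toReal := by norm_num
  have h1 : ∑ s ∈ S, ‖(if s b = i then ψ (Function.update s b j) else 0 : ℂ)‖ ^
      (2 : ℝ≥0∞).toReal =
      ∑ s ∈ S.filter (fun s => s b = i), ‖ψ (Function.update s b j)‖ ^ (2 : ℝ≥0∞).toReal := by
    rw [Finset.sum_filter]
    refine Finset.sum_congr rfl fun s _ => ?_
    split_ifs <;> simp
  have hinj : Set.InjOn (fun s : Bond → Fin d => Function.update s b j)
      (S.filter (fun s => s b = i) : Finset (Bond → Fin d)) := by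
    intro s hs t ht hst
    simp only [Finset.coe_filter, Set.mem_ofPred_eq] at hs ht
    funext c
    by_cases hc : c = b
    · subst hc; rw [hs.2, ht.2]
    · have := congrFun hst c
      simpa [hc] using this
  rw [h1, ← Finset.sum_image (f := fun t => ‖ψ t‖ ^ (2 : ℝ≥0∞).toReal) hinj]
  exact lp.sum_rpow_le_norm_rpow hp ψ _

/-- The matrix unit `e_{ij}` at the bond `b`, acting on `ℓ²` of the configurations. -/
def bondUnit (b : Bond) (i j : Fin d) : ConfigSpace d →L[ℂ] ConfigSpace d :=
  LinearMap.mkContinuous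
    { toFun := fun ψ => ⟨fun s => if s b = i then ψ (Function.update s b j) else 0,
        memℓp_gen' (unitFun_sum_le b i j ψ)⟩
      map_add' := fun ψ φ => by
        ext s
        change (if s b = i then (ψ + φ) (Function.update s b j) else 0 : ℂ) =
          (if s b = i then ψ (Function.update s b j) else 0) +
            (if s b = i then φ (Function.update s b j) else 0)
        by_cases h : s b = i <;> simp [h]
      map_smul' := fun c ψ => by
        ext s
        change (if s b = i then (c • ψ) (Function.update s b j) else 0 : ℂ) =
          c • (if s b = i then ψ (Function.update s b j) else 0)
        by_cases h : s b = i <;> simp [h] }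
    1 (fun ψ => by
      rw [one_mul]
      exact lp.norm_le_of_forall_sum_le (by norm_num) (norm_nonneg ψ) (unitFun_sum_le b i j ψ))

theorem bondUnit_apply (b : Bond) (i j : Fin d) (ψ : ConfigSpace d) (s : Bond → Fin d) :
    bondUnit b i j ψ s = if s b = i then ψ (Function.update s b j) else 0 := rfl

/-- The matrix `M` acting as an observable at the bond `b`:
`(M ψ)(s) = ∑ j, M (s b) j * ψ (s with value j at b)`. -/
def bondOp (b : Bond) (M : Matrix (Fin d) (Fin d) ℂ) : ConfigSpace d →L[ℂ] ConfigSpace d :=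
  ∑ i, ∑ j, M i j • bondUnit b i j

theorem bondOp_apply (b : Bond) (M : Matrix (Fin d) (Fin d) ℂ) (ψ : ConfigSpace d)
    (s : Bond → Fin d) :
    bondOp b M ψ s = ∑ j, M (s b) j * ψ (Function.update s b j) := by
  simp only [bondOp, sum_apply, smul_apply,
    lp.coeFn_sum, Finset.sum_apply, lp.coeFn_smul, Pi.smul_apply, bondUnit_apply, smul_eq_mul,
    mul_ite, mul_zero]
  simp

variable (d) in
/-- The observables `𝔄(F)` of a finite set of bonds. -/
def localAlgebra (F : Finset Bond) :
    StarSubalgebra ℂ (ConfigSpace d →L[ℂ] ConfigSpace d) :=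
  StarAlgebra.adjoin ℂ {T | ∃ b ∈ F, ∃ M : Matrix (Fin d) (Fin d) ℂ, T = bondOp b M}

variable (d) in
/-- The observables `𝔄(Λ)` of an arbitrary set of bonds: the norm closure of the union of the
algebras of the finite subsets. (The family is directed, so its supremum is its union.) -/
def regionAlgebra (Λ : Set Bond) :
    StarSubalgebra ℂ (ConfigSpace d →L[ℂ] ConfigSpace d) :=
  (⨆ F : {F : Finset Bond // (F : Set Bond) ⊆ Λ}, localAlgebra d F.1).topologicalClosure

variable (d) in
/-- The quasi-local algebra `𝔄` of all bonds. -/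
abbrev QuasiLocal : Type := regionAlgebra d Set.univ

/-! ### Von Neumann algebras -/

universe u
variable {H : Type u} [NormedAddCommGroup H] [InnerProductSpace ℂ H] [CompleteSpace H]

/-- The double commutant `S''` of a unital `*`-algebra `S` of operators. -/
def doubleCommutant (S : StarSubalgebra ℂ (H →L[ℂ] H)) : VonNeumannAlgebra H where
  toStarSubalgebra := 
    StarSubalgebra.centralizer ℂ (StarSubalgebra.centralizer ℂ (S : Set (H →L[ℂ] H)) :
      Set (H →L[ℂ] H))
  centralizer_centralizer' := by
    change Set.centralizer (Set.centralizer
      ((StarSubalgebra.centralizer ℂ (StarSubalgebra.centralizer ℂ (S : Set (H →L[ℂ] H)) :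
        Set (H →L[ℂ] H)) : StarSubalgebra ℂ (H →L[ℂ] H)) : Set (H →L[ℂ] H))) = _
    rw [StarSubalgebra.coe_centralizer_centralizer, Set.centralizer_centralizer_centralizer]
    exact (StarSubalgebra.coe_centralizer_centralizer _ _).symm

theorem coe_doubleCommutant (S : StarSubalgebra ℂ (H →L[ℂ] H)) :
    (doubleCommutant S : Set (H →L[ℂ] H)) =
      Set.centralizer (Set.centralizer (S : Set (H →L[ℂ] H))) := by
  change ((StarSubalgebra.centralizer ℂ (StarSubalgebra.centralizer ℂ (S : Set (H →L[ℂ] H)) :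
        Set (H →L[ℂ] H)) : StarSubalgebra ℂ (H →L[ℂ] H)) : Set (H →L[ℂ] H)) = _
  rw [StarSubalgebra.coe_centralizer_centralizer, StarMemClass.star_coe_eq, Set.union_self]

/-- A factor: the centre consists of the scalars. -/
def IsFactor (N : VonNeumannAlgebra H) : Prop :=
  ∀ x ∈ N, x ∈ N.commutant → ∃ c : ℂ, x = c • (1 : H →L[ℂ] H)

/-- A factor of Type I: a factor with a minimal projection, that is, a nonzero projection `e` in
`N` with `e N e = ℂ e`. -/
def IsTypeIFactor (N : VonNeumannAlgebra H) : Prop :=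
  IsFactor N ∧ ∃ e ∈ N, IsStarProjection e ∧ e ≠ 0 ∧ ∀ x ∈ N, ∃ c : ℂ, e * x * e = c • e

/-- `E` is a normal conditional expectation of `M` onto its subalgebra `N`. Operators carry the
Loewner order (`x ≤ y` iff `y - x` is a positive operator). -/
structure IsNormalCondExp (M N : VonNeumannAlgebra H)
    (E : M.toStarSubalgebra →ₗ[ℂ] N.toStarSubalgebra) : Prop where
  le : N ≤ M
  apply_of_mem : ∀ x : M.toStarSubalgebra, (x : H →L[ℂ] H) ∈ N → (E x : H →L[ℂ] H) = x
  bimodule : ∀ a x b : M.toStarSubalgebra, (a : H →L[ℂ] H) ∈ N → (b : H →L[ℂ] H) ∈ N →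
    (E (a * x * b) : H →L[ℂ] H) = a * (E x : H →L[ℂ] H) * b
  nonneg : ∀ x : M.toStarSubalgebra, 0 ≤ (x : H →L[ℂ] H) → 0 ≤ (E x : H →L[ℂ] H)
  /-- Normality: `E` preserves the suprema of bounded increasing nets of positive elements. -/
  normal : ∀ D : Set M.toStarSubalgebra, D.Nonempty →
    DirectedOn (fun x y : M.toStarSubalgebra => (x : H →L[ℂ] H) ≤ (y : H →L[ℂ] H)) D → (∀ x ∈ D, 0 ≤ (x : H →L[ℂ] H)) →
    ∀ x : M.toStarSubalgebra,
      IsLUB ((fun y : M.toStarSubalgebra => (y : H →L[ℂ] H)) '' D) x →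
      IsLUB ((fun y : M.toStarSubalgebra => (E y : H →L[ℂ] H)) '' D) (E x)

/-- The Pimsner-Popa bound `E(x) ≥ c x` for all positive `x ∈ M`. -/
def PimsnerPopaBound (M N : VonNeumannAlgebra H)
    (E : M.toStarSubalgebra →ₗ[ℂ] N.toStarSubalgebra) (c : ℝ) : Prop :=
  ∀ x : M.toStarSubalgebra, 0 ≤ (x : H →L[ℂ] H) →
    (c : ℂ) • (x : H →L[ℂ] H) ≤ (E x : H →L[ℂ] H)

/-- The Kosaki-Longo index `[M : N]`: the infimum of `c⁻¹` over all `c > 0` for which some normal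
conditional expectation of `M` onto `N` satisfies the Pimsner-Popa bound with constant `c`. It is
`∞` if there is none. For an irreducible inclusion there is at most one normal conditional
expectation, and this is `c⁻¹` for its best constant `c`. -/
def kosakiLongoIndex (M N : VonNeumannAlgebra H) : ℝ≥0∞ :=
  sInf {r | ∃ E : M.toStarSubalgebra →ₗ[ℂ] N.toStarSubalgebra, IsNormalCondExp M N E ∧
    ∃ c : ℝ, 0 < c ∧ PimsnerPopaBound M N E c ∧ r = (ENNReal.ofReal c)⁻¹}

/-! ### The net of von Neumann algebras of a representation -/

variable (π₀ : QuasiLocal d →⋆ₐ[ℂ] (H →L[ℂ] H))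

/-- A representation on a Hilbert space is irreducible if the space is nonzero and `{0}` and the
whole space are the only closed invariant subspaces. -/
def IsIrreducibleRep : Prop :=
  Nontrivial H ∧ ∀ K : Submodule ℂ H, IsClosed (K : Set H) →
    (∀ a : QuasiLocal d, ∀ ξ ∈ K, π₀ a ξ ∈ K) → K = ⊥ ∨ K = ⊤

/-- `ℛ(Λ) = π₀(𝔄(Λ))''`. -/
def coneAlgebra (Λ : Set Bond) : VonNeumannAlgebra H :=
  doubleCommutant (((regionAlgebra d Λ).comap (regionAlgebra d Set.univ).subtype).map π₀)

/-- `ℛ̂(Λ) = ℛ(Λᶜ)'`. -/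
def dualAlgebra (Λ : Set Bond) : VonNeumannAlgebra H := (coneAlgebra π₀ Λᶜ).commutant

/-- Haag duality for cones. -/
def HaagDuality : Prop :=
  ∀ Λ : Set Bond, IsCone Λ → coneAlgebra π₀ Λ = (coneAlgebra π₀ Λᶜ).commutant

/-- `ll` is a relation on cones that witnesses the distal split property of `π₀`. -/
def IsDistalSplitRelation (ll : Set Bond → Set Bond → Prop) : Prop :=
  ∀ Λ₁ Λ₂ : Set Bond, IsCone Λ₁ → IsCone Λ₂ → ll Λ₁ Λ₂ →
    Λ₁ ⊆ Λ₂ ∧ ∃ N : VonNeumannAlgebra H,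
      IsTypeIFactor N ∧ coneAlgebra π₀ Λ₁ ≤ N ∧ N ≤ coneAlgebra π₀ Λ₂

/-- `Λ₁` and `Λ₂` are cones, and some cone `Λ` separates them: `Λ₁ ≪ Λ` and `Λ₂ ⊆ Λᶜ`. -/
def IsSeparatedPair (ll : Set Bond → Set Bond → Prop) (Λ₁ Λ₂ : Set Bond) : Prop :=
  IsCone Λ₁ ∧ IsCone Λ₂ ∧ ∃ Λ : Set Bond, IsCone Λ ∧ ll Λ₁ Λ ∧ Λ₂ ⊆ Λᶜ

/-- `Γ = Λ₁ ∪ Λ₂` exhibits `Γ` as an element of `𝒞²`; the two cones may be listed in either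
order. Thus `𝒞²` is the set of all `Γ` that have such a decomposition. -/
def IsConePair (ll : Set Bond → Set Bond → Prop) (Γ Λ₁ Λ₂ : Set Bond) : Prop :=
  Γ = Λ₁ ∪ Λ₂ ∧ (IsSeparatedPair ll Λ₁ Λ₂ ∨ IsSeparatedPair ll Λ₂ Λ₁)

end SpinModel

end

/-! A normal conditional expectation `E` of ℛ̂(Γ') onto ℛ(Γ') restricts to one of ℛ̂(Γ) onto ℛ(Γ)
with the same Pimsner-Popa constant, and this gives the inequality. The point is that `E` maps ℛ̂(Γ)
into ℛ(Γ). For x in ℛ̂(Γ), the algebras ℛ(Λᵢ' \ Λᵢ) lie in ℛ(Γ') and commute with x, so by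
bimodularity they commute with E(x). It remains to see that an element of ℛ(Λ₁' ∪ Λ₂') commuting
with both of them lies in ℛ(Λ₁ ∪ Λ₂): `mem_coneAlgebra_union_of_commute`.

For one cone this is Haag duality. For two, the split Type I factor N satisfies ℛ(Λ₁') ⊆ N and
ℛ(Λ₂') ⊆ N', so the cones sit in different tensor factors and Tomita's commutation theorem for
tensor products reduces the claim to single cones. That theorem is `IsProductVector.commute`: if P ⊆
N and Q ⊆ N', then everything in (P ∪ Q)' commutes with everything that commutes with P' ∩ N and Q'
∩ N'. No tensor decomposition is built; a product vector ω replaces it, n n' ω playing the part of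
nω ⊗ n'ω.

The proof uses real subspaces. For self-adjoint x and y of the two kinds, it suffices that ⟪xω, yω⟫
is real for every product vector, and this holds once yω lies in the closed real span of P_sa Q_sa
ω. The component ξ of yω orthogonal to that span defines an antilinear map T with ⟪T k, l⟫ = ⟪ξ, k ⊗
l⟫. The duality between P_sa ω and (P' ∩ N)_sa ω (`IsProductVector.eq_zero_of_real_orthogonal`)
forces T = 0 (`eq_zero_of_antilinear`). -/

noncomputable section

namespace SpinModel

/-! ### Real subspaces of two Hilbert spaces and antilinear maps between them -/

section RealCore

open ContinuousLinearMap

variable {K L : Type*} [NormedAddCommGroup K] [InnerProductSpace ℝ K] [CompleteSpace K]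
  [NormedAddCommGroup L] [InnerProductSpace ℝ L] [CompleteSpace L]

/-- If `X` anticommutes with the positive operator `T† T`, then `T X = 0`. -/
theorem comp_eq_zero_of_anticommute (T : K →L[ℝ] L) (X : K →L[ℝ] K)
    (h : ∀ v, adjoint T (T (X v)) = -X (adjoint T (T v))) (v : K) : T (X v) = 0 := by
  set S : K →L[ℝ] K := adjoint T ∘L T with hS
  have hSin : ∀ x, ⟪S x, x⟫_ℝ = ‖T x‖ ^ 2 := fun x => by
    rw [hS, coe_comp, Function.comp_apply, adjoint_inner_left, real_inner_self_eq_norm_sq]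
  have hSsymm : ∀ x y, ⟪S x, y⟫_ℝ = ⟪x, S y⟫_ℝ := fun x y => by
    simp only [hS, coe_comp, Function.comp_apply, adjoint_inner_left, adjoint_inner_right]
  have hSX : ∀ x, S (X x) = -X (S x) := h
  -- With t = 1 / c one has t‖T‖² ≤ 1, so 1 - tS is a contraction. As (1 + tS)X = X(1 - tS), the
  -- vectors (1 + tS)ⁿ X v stay bounded, yet their squared norms grow linearly in n unless T X v =
  -- 0.
  set c : ℝ := 1 + ‖T‖ ^ 2 with hc
  have hc0 : 0 < c := by positivity
  set t : ℝ := c⁻¹ with ht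
  have ht0 : 0 < t := inv_pos.mpr hc0
  set W : K →L[ℝ] K := ContinuousLinearMap.id ℝ K + t • S with hW
  set W' : K →L[ℝ] K := ContinuousLinearMap.id ℝ K - t • S with hW'
  have hWX : ∀ x, W (X x) = X (W' x) := fun x => by
    simp [hW, hW', hSX, sub_eq_add_neg]
  have hW'norm : ∀ x, ‖W' x‖ ≤ ‖x‖ := fun x => by
    have h1 : ‖W' x‖ ^ 2 = ‖x‖ ^ 2 - 2 * t * ‖T x‖ ^ 2 + t ^ 2 * ‖S x‖ ^ 2 := by
      have : W' x = x - t • S x := by simp [hW']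
      rw [this, @norm_sub_sq_real, inner_smul_right, real_inner_comm, hSin, norm_smul]
      rw [mul_pow, Real.norm_eq_abs, sq_abs]; ring
    have h2 : ‖S x‖ ≤ ‖T‖ * ‖T x‖ := by
      have := (adjoint T).le_opNorm (T x)
      rwa [LinearIsometryEquiv.norm_map] at this
    have h3 : ‖S x‖ ^ 2 ≤ ‖T‖ ^ 2 * ‖T x‖ ^ 2 := by
      rw [← mul_pow]; gcongr
    have h4 : t * ‖T‖ ^ 2 ≤ 1 := by
      rw [ht, inv_mul_le_iff₀ hc0]; linarith
    have h5 : t ^ 2 * ‖S x‖ ^ 2 ≤ t * ‖T x‖ ^ 2 := by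
      calc t ^ 2 * ‖S x‖ ^ 2 ≤ t ^ 2 * (‖T‖ ^ 2 * ‖T x‖ ^ 2) := by gcongr
        _ = (t * ‖T‖ ^ 2) * (t * ‖T x‖ ^ 2) := by ring
        _ ≤ 1 * (t * ‖T x‖ ^ 2) := by gcongr
        _ = _ := one_mul _
    have h6 : 0 ≤ t * ‖T x‖ ^ 2 := by positivity
    exact le_of_sq_le_sq (by linarith) (norm_nonneg x)
  have hbound : ∀ n : ℕ, ∃ x, ‖x‖ ≤ ‖v‖ ∧ (W^[n]) (X v) = X x := fun n => by
    induction n with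
    | zero => exact ⟨v, le_rfl, rfl⟩
    | succ n ih =>
      obtain ⟨x, hx, he⟩ := ih
      exact ⟨W' x, (hW'norm x).trans hx, by rw [Function.iterate_succ_apply', he, hWX]⟩
  have hWapp : ∀ x, W x = x + t • S x := fun x => by simp [hW]
  have hgrow : ∀ x, ‖x‖ ^ 2 + 2 * t * ‖T x‖ ^ 2 ≤ ‖W x‖ ^ 2 := fun x => by
    rw [hWapp, @norm_add_sq_real, inner_smul_right, real_inner_comm, hSin]
    nlinarith [sq_nonneg ‖t • S x‖]
  have hmono : ∀ x, ‖T x‖ ^ 2 ≤ ‖T (W x)‖ ^ 2 := fun x => by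
    have : ‖T (W x)‖ ^ 2 = ‖T x‖ ^ 2 + 2 * t * ‖S x‖ ^ 2 + t ^ 2 * ‖T (S x)‖ ^ 2 := by
      rw [hWapp, map_add, map_smul, @norm_add_sq_real, inner_smul_right, norm_smul, mul_pow,
        Real.norm_eq_abs, sq_abs, ← adjoint_inner_right T]
      have : (adjoint T) (T (S x)) = S (S x) := rfl
      rw [this, ← hSsymm, real_inner_self_eq_norm_sq]; ring
    rw [this]
    have : 0 ≤ 2 * t * ‖S x‖ ^ 2 + t ^ 2 * ‖T (S x)‖ ^ 2 := by positivity
    linarith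
  have hiter : ∀ n : ℕ, ‖T (X v)‖ ^ 2 ≤ ‖T ((W^[n]) (X v))‖ ^ 2 ∧
      2 * t * n * ‖T (X v)‖ ^ 2 ≤ ‖(W^[n]) (X v)‖ ^ 2 := fun n => by
    induction n with
    | zero => simp
    | succ n ih =>
      rw [Function.iterate_succ_apply']
      refine ⟨ih.1.trans (hmono _), ?_⟩
      have h1 := hgrow ((W^[n]) (X v))
      have h2 : 2 * t * ‖T (X v)‖ ^ 2 ≤ 2 * t * ‖T ((W^[n]) (X v))‖ ^ 2 := by
        exact mul_le_mul_of_nonneg_left ih.1 (by positivity)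
      push_cast
      linarith [ih.2]
  by_contra hne
  have hpos : 0 < 2 * t * ‖T (X v)‖ ^ 2 := by
    have := norm_pos_iff.mpr hne
    positivity
  obtain ⟨n, hn⟩ := exists_nat_gt ((‖X‖ * ‖v‖) ^ 2 / (2 * t * ‖T (X v)‖ ^ 2))
  rw [div_lt_iff₀ hpos] at hn
  obtain ⟨x, hx, he⟩ := hbound n
  have h1 := (hiter n).2
  rw [he] at h1
  have h2 : ‖X x‖ ^ 2 ≤ (‖X‖ * ‖v‖) ^ 2 := by
    gcongr
    exact (X.le_opNorm x).trans (by gcongr)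
  linarith

/-- `J` is a complex structure compatible with the real inner product. -/
structure IsComplexStructure (J : K →L[ℝ] K) : Prop where
  sq : ∀ x, J (J x) = -x
  skew : ∀ x y, ⟪J x, y⟫_ℝ = -⟪x, J y⟫_ℝ

/-- An antilinear map which sends `A` to `Bᗮ` and `Aᗮ` to `i Bᗮᗮ` vanishes, provided that
`A` and `B` generate their spaces over the complex numbers. -/
theorem eq_zero_of_antilinear {J : K →L[ℝ] K} {J' : L →L[ℝ] L} (hJ : IsComplexStructure J)
    (hJ' : IsComplexStructure J') (T : K →L[ℝ] L) (hT : ∀ k, T (J k) = -J' (T k))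
    (A : Submodule ℝ K) (B : Submodule ℝ L)
    (hA : ∀ k ∈ Aᗮ, J k ∈ Aᗮ → k = 0) (hB : ∀ l ∈ Bᗮ, J' l ∈ Bᗮ → l = 0)
    (h1 : ∀ a ∈ A, ∀ b ∈ B, ⟪T a, b⟫_ℝ = 0) (h2 : ∀ c ∈ Aᗮ, ∀ d ∈ Bᗮ, ⟪T c, J' d⟫_ℝ = 0) :
    T = 0 := by
  have hTa : ∀ l, adjoint T (J' l) = -J (adjoint T l) := fun l => by
    refine ext_inner_right ℝ fun k => ?_
    rw [adjoint_inner_left, hJ'.skew, inner_neg_left, hJ.skew, adjoint_inner_left, hT,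
      inner_neg_right, neg_neg]
  have hTb : ∀ b ∈ B, adjoint T b ∈ Aᗮ := fun b hb => by
    rw [Submodule.mem_orthogonal]
    intro a ha
    rw [adjoint_inner_right, h1 a ha b hb]
  have e1 : ∀ a ∈ Aᗮᗮ, T a ∈ Bᗮ := fun a ha => by
    rw [Submodule.mem_orthogonal]
    intro b hb
    rw [← adjoint_inner_left]
    exact (Submodule.mem_orthogonal _ _).1 ha _ (hTb b hb)
  have e2 : ∀ c ∈ Aᗮ, J' (T c) ∈ Bᗮᗮ := fun c hc => by
    rw [Submodule.mem_orthogonal']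
    intro d hd
    rw [hJ'.skew, h2 c hc d hd, neg_zero]
  have e3 : ∀ d ∈ Bᗮ, J (adjoint T d) ∈ Aᗮᗮ := fun d hd => by
    rw [Submodule.mem_orthogonal']
    intro c hc
    rw [hJ.skew, adjoint_inner_left, hT, inner_neg_right, neg_neg]
    exact (Submodule.mem_orthogonal _ _).1 (e2 c hc) d hd
  have e4 : ∀ b ∈ Bᗮᗮ, adjoint T b ∈ Aᗮ := fun b hb => by
    rw [Submodule.mem_orthogonal]
    intro a ha
    rw [adjoint_inner_right]
    exact (Submodule.mem_orthogonal _ _).1 hb _ (e1 a (Submodule.le_orthogonal_orthogonal A ha))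
  have hJneg : ∀ x y, J x = y → x = -J y := fun x y h => by rw [← h, hJ.sq, neg_neg]
  set S : K → K := fun x => adjoint T (T x) with hS
  -- J S preserves both Aᗮᗮ and Aᗮ, hence commutes with the projection R onto Aᗮᗮ.
  have f1 : ∀ a ∈ Aᗮᗮ, J (S a) ∈ Aᗮᗮ := fun a ha => e3 _ (e1 a ha)
  have f2 : ∀ c ∈ Aᗮ, J (S c) ∈ Aᗮ := fun c hc => by
    have := e4 _ (e2 c hc)
    rw [hTa] at this
    simpa using this
  set R : K →L[ℝ] K := Aᗮᗮ.starProjection with hR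
  have hRmem : ∀ x, R x ∈ Aᗮᗮ := fun x => Submodule.starProjection_apply_mem _ _
  have hRc : ∀ x, x - R x ∈ Aᗮ := fun x => by
    have := Submodule.sub_starProjection_mem_orthogonal (K := Aᗮᗮ) x
    rwa [Submodule.triorthogonal_eq_orthogonal] at this
  have hRJS : ∀ x, R (J (S x)) = J (S (R x)) := fun x => by
    refine (Submodule.eq_starProjection_of_mem_orthogonal (f1 _ (hRmem x)) ?_)
    rw [Submodule.triorthogonal_eq_orthogonal, ← map_sub]
    have : S x - S (R x) = S (x - R x) := by simp [hS]
    rw [this]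
    exact f2 _ (hRc x)
  have hSJ : ∀ x, S (J x) = J (S x) := fun x => by
    simp only [hS, hT, map_neg, hTa, neg_neg]
  -- S commutes with J because T is antilinear, and R commutes with J S. Together these make S
  -- anticommute with the commutator X.
  set X : K →L[ℝ] K := R ∘L J - J ∘L R with hX
  have hXapp : ∀ x, X x = R (J x) - J (R x) := fun x => rfl
  have hTX : ∀ v, T (X v) = 0 := comp_eq_zero_of_anticommute T X fun v => by
    change S (X v) = -X (S v)
    have hSsub : S (R (J v) - J (R v)) = S (R (J v)) - S (J (R v)) := by simp [hS]
    rw [hXapp, hXapp, hSsub, hSJ, hRJS]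
    have := hRJS (J v)
    rw [hSJ, hJ.sq, map_neg] at this
    rw [hJneg _ _ this.symm]
    simp
  -- T X = 0 reads T R J = -J' T R, so T R v and J' T R v both lie in Bᗮ.
  have hTR : ∀ v, T (R v) = 0 := fun v => by
    have h3 := hTX v
    rw [hXapp, map_sub, hT, sub_neg_eq_add] at h3
    refine hB _ (e1 _ (hRmem v)) ?_
    rw [← neg_eq_of_add_eq_zero_right h3]
    exact Submodule.neg_mem _ (e1 _ (hRmem _))
  have hker : ∀ a ∈ A, T a = 0 := fun a ha => by
    have : R a = a := Submodule.starProjection_eq_self_iff.2 (Submodule.le_orthogonal_orthogonal A ha)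
    rw [← this, hTR]
  have hTadj : ∀ l, adjoint T l = 0 := fun l => by
    refine hA _ ?_ ?_
    · rw [Submodule.mem_orthogonal]
      intro a ha
      rw [adjoint_inner_right, hker a ha, inner_zero_left]
    · rw [Submodule.mem_orthogonal']
      intro a ha
      rw [hJ.skew, adjoint_inner_left, hT, hker a ha]
      simp
  ext k
  refine ext_inner_left ℝ fun l => ?_
  rw [← adjoint_inner_left, hTadj]
  simp

end RealCore

section Operators

open ContinuousLinearMap

variable {H : Type*} [NormedAddCommGroup H] [InnerProductSpace ℂ H] [CompleteSpace H]

/-! ### Cyclic subspaces -/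

/-- The closed subspace `closure (S ω)`. -/
def cyclicSubspace (S : StarSubalgebra ℂ (H →L[ℂ] H)) (ω : H) : Submodule ℂ H :=
  (S.toSubalgebra.toSubmodule.map (ContinuousLinearMap.apply ℂ H ω).toLinearMap).topologicalClosure

variable {S : StarSubalgebra ℂ (H →L[ℂ] H)} {ω : H}

instance : CompleteSpace (cyclicSubspace S ω) :=
  (Submodule.isClosed_topologicalClosure _).completeSpace_coe

theorem isClosed_cyclicSubspace : IsClosed (cyclicSubspace S ω : Set H) :=
  Submodule.isClosed_topologicalClosure _

theorem apply_mem_cyclicSubspace {s : H →L[ℂ] H} (hs : s ∈ S) : s ω ∈ cyclicSubspace S ω :=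
  Submodule.le_topologicalClosure _ ⟨s, hs, rfl⟩

theorem self_mem_cyclicSubspace : ω ∈ cyclicSubspace S ω :=
  apply_mem_cyclicSubspace (s := 1) (one_mem S)

theorem cyclicSubspace_induction {p : H → Prop} (hp : IsClosed {x | p x})
    (h : ∀ s ∈ S, p (s ω)) {x : H} (hx : x ∈ cyclicSubspace S ω) : p x := by
  have : (cyclicSubspace S ω : Set H) ⊆ {x | p x} := by
    refine closure_minimal ?_ hp
    rintro _ ⟨s, hs, rfl⟩
    exact h s hs
  exact this hx

theorem cyclicSubspace_mono {S' : StarSubalgebra ℂ (H →L[ℂ] H)} (h : S ≤ S') :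
    cyclicSubspace S ω ≤ cyclicSubspace S' ω := fun _ hx =>
  cyclicSubspace_induction isClosed_cyclicSubspace (fun _ hs => apply_mem_cyclicSubspace (h hs)) hx

theorem smul_mem_cyclicSubspace {s : H →L[ℂ] H} (hs : s ∈ S) {x : H}
    (hx : x ∈ cyclicSubspace S ω) : s x ∈ cyclicSubspace S ω :=
  cyclicSubspace_induction (p := fun x => s x ∈ cyclicSubspace S ω)
    (isClosed_cyclicSubspace.preimage s.continuous)
    (fun t ht => apply_mem_cyclicSubspace (s := s * t) (mul_mem hs ht)) hx

theorem mem_orthogonal_cyclicSubspace {x : H} (h : ∀ s ∈ S, ⟪s ω, x⟫_ℂ = 0) :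
    x ∈ (cyclicSubspace S ω)ᗮ := by
  rw [Submodule.mem_orthogonal]
  intro u hu
  exact cyclicSubspace_induction (p := fun u => ⟪u, x⟫_ℂ = 0)
    (isClosed_eq (by fun_prop) continuous_const) h hu

theorem star_inner_left (s : H →L[ℂ] H) (x y : H) : ⟪star s x, y⟫_ℂ = ⟪x, s y⟫_ℂ :=
  adjoint_inner_left s y x

theorem star_inner_right (s : H →L[ℂ] H) (x y : H) : ⟪x, star s y⟫_ℂ = ⟪s x, y⟫_ℂ :=
  adjoint_inner_right s x y

theorem smul_mem_orthogonal_cyclicSubspace {s : H →L[ℂ] H} (hs : s ∈ S) {x : H}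
    (hx : x ∈ (cyclicSubspace S ω)ᗮ) : s x ∈ (cyclicSubspace S ω)ᗮ := by
  rw [Submodule.mem_orthogonal] at hx ⊢
  intro u hu
  rw [← star_inner_left]
  exact hx _ (smul_mem_cyclicSubspace (star_mem hs) hu)

theorem starProjection_cyclicSubspace_commute {s : H →L[ℂ] H} (hs : s ∈ S) :
    s * (cyclicSubspace S ω).starProjection = (cyclicSubspace S ω).starProjection * s := by
  ext x
  refine (Submodule.eq_starProjection_of_mem_orthogonal
    (smul_mem_cyclicSubspace hs (Submodule.starProjection_apply_mem _ _)) ?_).symm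
  change s x - s _ ∈ _
  rw [← map_sub]
  exact smul_mem_orthogonal_cyclicSubspace hs (Submodule.sub_starProjection_mem_orthogonal x)

/-- Two vectors with the same vector functional on `S` are related by a contraction which
commutes with `S`. -/
theorem exists_commuting_contraction {η ζ : H} (h : ∀ s ∈ S, ⟪η, s η⟫_ℂ = ⟪ζ, s ζ⟫_ℂ) :
    ∃ u : H →L[ℂ] H, (∀ s ∈ S, s * u = u * s) ∧ (∀ x, ‖u x‖ ≤ ‖x‖) ∧ u η = ζ := by
  set V := cyclicSubspace S η
  set e : S →ₗ[ℂ] V :=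
    { toFun := fun s => ⟨(s : H →L[ℂ] H) η, apply_mem_cyclicSubspace s.2⟩
      map_add' := fun _ _ => rfl
      map_smul' := fun _ _ => rfl } with he
  set f : S →ₗ[ℂ] H :=
    { toFun := fun s => (s : H →L[ℂ] H) ζ
      map_add' := fun _ _ => rfl
      map_smul' := fun _ _ => rfl } with hf
  -- Equality of the two functionals at `star s * s` makes s η ↦ s ζ well defined and isometric.
  have hnorm : ∀ s, ‖f s‖ ≤ 1 * ‖e s‖ := fun s => by
    rw [one_mul]
    refine le_of_sq_le_sq (le_of_eq ?_) (norm_nonneg _)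
    have : ⟪(s : H →L[ℂ] H) η, (s : H →L[ℂ] H) η⟫_ℂ = ⟪(s : H →L[ℂ] H) ζ, (s : H →L[ℂ] H) ζ⟫_ℂ := by
      rw [← star_inner_right, ← star_inner_right]
      exact h _ (mul_mem (star_mem s.2) s.2)
    rw [inner_self_eq_norm_sq_to_K, inner_self_eq_norm_sq_to_K] at this
    exact_mod_cast this.symm
  have hdense : DenseRange e := by
    refine Subtype.dense_iff.2 (closure_mono ?_)
    rintro _ ⟨s, hs, rfl⟩
    exact ⟨e ⟨s, hs⟩, ⟨_, rfl⟩, rfl⟩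
  set g := f.extendOfNorm e
  have hg : ∀ s, g (e s) = f s := LinearMap.extendOfNorm_eq hdense ⟨1, hnorm⟩
  have hgn : ∀ x, ‖g x‖ ≤ 1 * ‖x‖ := LinearMap.norm_extendOfNorm_apply_le hdense 1 hnorm
  -- The map is extended by zero to Vᗮ, which S also leaves invariant.
  refine ⟨g ∘L V.orthogonalProjectionOnto, ?_, ?_, ?_⟩
  · intro s hs
    ext x
    have h1 : V.orthogonalProjectionOnto (s x) =
        ⟨s (V.orthogonalProjectionOnto x), smul_mem_cyclicSubspace hs (Subtype.coe_prop _)⟩ := by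
      ext
      have := DFunLike.congr_fun (starProjection_cyclicSubspace_commute (ω := η) hs) x
      exact this.symm
    change s (g _) = g (V.orthogonalProjectionOnto (s x))
    rw [h1]
    generalize V.orthogonalProjectionOnto x = y
    refine hdense.induction_on (p := fun y : V => s (g y) =
      g ⟨s y, smul_mem_cyclicSubspace hs y.2⟩) y
      (isClosed_eq (by fun_prop) (by fun_prop)) fun t => ?_
    rw [hg]
    exact (hg (⟨s, hs⟩ * t)).symm
  · intro x
    refine (hgn _).trans ?_
    rw [one_mul]
    exact Submodule.norm_orthogonalProjectionOnto_apply_le V x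
  · have h1 : V.orthogonalProjectionOnto η = e 1 := by
      ext
      exact Submodule.starProjection_eq_self_iff.2 self_mem_cyclicSubspace
    change g (V.orthogonalProjectionOnto η) = ζ
    rw [h1, hg]
    rfl

end Operators

/-! ### Real duality inside complex Hilbert spaces -/

section ComplexCore

open ContinuousLinearMap

attribute [local instance] InnerProductSpace.complexToReal

/-- Multiplication by `i` as a real operator. -/
def mulI (E : Type*) [NormedAddCommGroup E] [InnerProductSpace ℂ E] : E →L[ℝ] E :=
  (Complex.I • ContinuousLinearMap.id ℂ E).restrictScalars ℝ

theorem mulI_apply {E : Type*} [NormedAddCommGroup E] [InnerProductSpace ℂ E] (x : E) :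
    mulI E x = Complex.I • x := rfl

theorem isComplexStructure_mulI (E : Type*) [NormedAddCommGroup E] [InnerProductSpace ℂ E] :
    IsComplexStructure (mulI E) where
  sq x := by rw [mulI_apply, mulI_apply, smul_smul, Complex.I_mul_I, neg_one_smul]
  skew x y := by
    rw [real_inner_eq_re_inner ℂ, real_inner_eq_re_inner ℂ, mulI_apply, mulI_apply,
      inner_smul_left, inner_smul_right]
    simp

theorem real_inner_mulI_left {E : Type*} [NormedAddCommGroup E] [InnerProductSpace ℂ E] (x y : E) :
    ⟪mulI E x, y⟫_ℝ = (⟪x, y⟫_ℂ).im := by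
  rw [real_inner_eq_re_inner ℂ, mulI_apply, inner_smul_left]
  simp

theorem real_inner_mulI_right {E : Type*} [NormedAddCommGroup E] [InnerProductSpace ℂ E] (x y : E) :
    ⟪x, mulI E y⟫_ℝ = -(⟪x, y⟫_ℂ).im := by
  rw [real_inner_eq_re_inner ℂ, mulI_apply, inner_smul_right]
  simp

/-- A subspace contained in a closed subspace `Wᗮ`, with no nonzero vector of `Wᗮ` orthogonal to
it, is dense in `Wᗮ`. -/
theorem orthogonal_le_double_orthogonal {E : Type*} [NormedAddCommGroup E] [InnerProductSpace ℝ E]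
    [CompleteSpace E] {U W : Submodule ℝ E} (hUW : U ≤ Wᗮ) (h : ∀ x ∈ Wᗮ, x ∈ Uᗮ → x = 0) :
    Wᗮ ≤ Uᗮᗮ := by
  intro x hx
  have h1 : Uᗮᗮ ≤ Wᗮ := by
    rw [← Submodule.triorthogonal_eq_orthogonal (K := W)]
    exact Submodule.orthogonal_le (Submodule.orthogonal_le hUW)
  have h2 : x - Uᗮᗮ.starProjection x ∈ Uᗮ := by
    have := Submodule.sub_starProjection_mem_orthogonal (K := Uᗮᗮ) x
    rwa [Submodule.triorthogonal_eq_orthogonal] at this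
  have h3 := h _ (Submodule.sub_mem _ hx (h1 (Submodule.starProjection_apply_mem _ _))) h2
  rw [sub_eq_zero.1 h3]
  exact Submodule.starProjection_apply_mem _ _

theorem mem_orthogonal_span {E : Type*} [NormedAddCommGroup E] [InnerProductSpace ℝ E]
    {s : Set E} {x : E} : x ∈ (Submodule.span ℝ s)ᗮ ↔ ∀ a ∈ s, ⟪a, x⟫_ℝ = 0 := by
  rw [Submodule.mem_orthogonal]
  refine ⟨fun h a ha => h a (Submodule.subset_span ha), fun h a ha => ?_⟩
  induction ha using Submodule.span_induction with
  | mem a ha => exact h a ha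
  | zero => exact inner_zero_left _
  | add a b _ _ h1 h2 => rw [inner_add_left, h1, h2, add_zero]
  | smul c a _ h1 => rw [real_inner_smul_left, h1, mul_zero]

/-- `A` and `A'` are sets of vectors whose inner products with each other are real, such that `A + i A'` is total over the reals and `A` is total over the complex numbers. -/
structure IsRealDualPair {K : Type*} [NormedAddCommGroup K] [InnerProductSpace ℂ K]
    (A A' : Set K) : Prop where
  im_inner : ∀ a ∈ A, ∀ a' ∈ A', (⟪a, a'⟫_ℂ).im = 0
  total : ∀ k, (∀ a ∈ A, (⟪a, k⟫_ℂ).re = 0) → (∀ a' ∈ A', (⟪a', k⟫_ℂ).im = 0) → k = 0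
  complex_total : ∀ k, (∀ a ∈ A, ⟪a, k⟫_ℂ = 0) → k = 0

theorem IsRealDualPair.eq_zero {K : Type*} [NormedAddCommGroup K] [InnerProductSpace ℂ K]
    {A A' : Set K} (h : IsRealDualPair A A') (k : K)
    (hk : k ∈ (Submodule.span ℝ A)ᗮ) (hk' : mulI K k ∈ (Submodule.span ℝ A)ᗮ) : k = 0 := by
  refine h.complex_total k fun a ha => Complex.ext ?_ ?_
  · exact mem_orthogonal_span.1 hk a ha
  · have := mem_orthogonal_span.1 hk' a ha
    rwa [real_inner_mulI_right, neg_eq_zero] at this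

variable {K L : Type*} [NormedAddCommGroup K] [InnerProductSpace ℂ K] [CompleteSpace K]
  [NormedAddCommGroup L] [InnerProductSpace ℂ L] [CompleteSpace L]

/-- Realness of the inner products puts i A' inside Aᗮ, and `total` leaves no nonzero vector of Aᗮ
orthogonal to it. Conditions on A' therefore control all of Aᗮ. -/
theorem IsRealDualPair.orthogonal_le {A A' : Set K} (h : IsRealDualPair A A') :
    (Submodule.span ℝ A)ᗮ ≤ (Submodule.span ℝ (mulI K '' A'))ᗮᗮ := by
  refine orthogonal_le_double_orthogonal ?_ ?_
  · rw [Submodule.span_le]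
    rintro _ ⟨a', ha', rfl⟩
    refine mem_orthogonal_span.2 fun a ha => ?_
    rw [real_inner_mulI_right, h.im_inner a ha a' ha', neg_zero]
  · intro x hx hx'
    refine h.total x (fun a ha => mem_orthogonal_span.1 hx a ha) fun a' ha' => ?_
    rw [← real_inner_mulI_left]
    exact mem_orthogonal_span.1 hx' _ ⟨a', ha', rfl⟩

/-- An antilinear map `T` with `⟪T a, b⟫` imaginary on `A × B` and real on `A' × B'` vanishes. -/
theorem IsRealDualPair.antilinear_eq_zero {A A' : Set K} {B B' : Set L} (hA : IsRealDualPair A A')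
    (hB : IsRealDualPair B B') (T : K →L[ℝ] L) (hT : ∀ k, T (Complex.I • k) = -(Complex.I • T k))
    (h1 : ∀ a ∈ A, ∀ b ∈ B, (⟪T a, b⟫_ℂ).re = 0)
    (h2 : ∀ a' ∈ A', ∀ b' ∈ B', (⟪T a', b'⟫_ℂ).im = 0) : T = 0 := by
  have hT' : ∀ k, T (mulI K k) = -mulI L (T k) := hT
  refine eq_zero_of_antilinear (isComplexStructure_mulI K) (isComplexStructure_mulI L) T hT
    (Submodule.span ℝ A) (Submodule.span ℝ B) hA.eq_zero hB.eq_zero ?_ ?_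
  · intro a ha b hb
    have e1 : ∀ b ∈ B, adjoint T b ∈ (Submodule.span ℝ A)ᗮ := fun b hb =>
      mem_orthogonal_span.2 fun a ha => by
        rw [adjoint_inner_right]; exact h1 a ha b hb
    have e2 : T a ∈ (Submodule.span ℝ B)ᗮ := mem_orthogonal_span.2 fun b hb => by
      rw [real_inner_comm, ← adjoint_inner_right]
      exact (Submodule.mem_orthogonal _ _).1 (e1 b hb) a ha
    exact (Submodule.mem_orthogonal' _ _).1 e2 b hb
  · intro c hc d hd
    have e1 : ∀ b' ∈ B', adjoint T b' ∈ (Submodule.span ℝ (mulI K '' A'))ᗮ := fun b' hb' => by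
      refine mem_orthogonal_span.2 ?_
      rintro _ ⟨a', ha', rfl⟩
      rw [adjoint_inner_right, hT', inner_neg_left, real_inner_mulI_left, h2 a' ha' b' hb', neg_zero]
    have e2 : mulI L (T c) ∈ (Submodule.span ℝ (mulI L '' B'))ᗮ := by
      refine mem_orthogonal_span.2 ?_
      rintro _ ⟨b', hb', rfl⟩
      rw [(isComplexStructure_mulI L).skew, (isComplexStructure_mulI L).sq, inner_neg_right,
        neg_neg, ← adjoint_inner_left]
      exact (Submodule.mem_orthogonal _ _).1 (hA.orthogonal_le hc) _ (e1 b' hb')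
    rw [← neg_eq_zero, ← (isComplexStructure_mulI L).skew]
    exact (Submodule.mem_orthogonal _ _).1 (hB.orthogonal_le hd) _ e2

end ComplexCore

section ProductVectors

open ContinuousLinearMap

variable {H : Type*} [NormedAddCommGroup H] [InnerProductSpace ℂ H] [CompleteSpace H]

/-! ### Product vectors of a von Neumann algebra and its commutant -/

theorem exists_selfAdjoint_add {S : StarSubalgebra ℂ (H →L[ℂ] H)} {a : H →L[ℂ] H} (ha : a ∈ S) :
    ∃ b ∈ S, ∃ c ∈ S, IsSelfAdjoint b ∧ IsSelfAdjoint c ∧ a = b + Complex.I • c := by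
  refine ⟨realPart a, ?_, imaginaryPart a, ?_, (realPart a).2, (imaginaryPart a).2,
    (realPart_add_I_smul_imaginaryPart a).symm⟩
  · rw [realPart_apply_coe, ← Complex.coe_smul]
    exact S.smul_mem (add_mem ha (star_mem ha)) _
  · rw [imaginaryPart_apply_coe, ← Complex.coe_smul]
    exact S.smul_mem (S.smul_mem (sub_mem ha (star_mem ha)) _) _

/-- Since P and Q commute, every word in their elements can be sorted into a single product a * b.
-/
theorem adjoin_union_induction {P Q : StarSubalgebra ℂ (H →L[ℂ] H)}
    (hPQ : ∀ a ∈ P, ∀ b ∈ Q, a * b = b * a) {p : (H →L[ℂ] H) → Prop} (zero : p 0)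
    (add : ∀ x y, p x → p y → p (x + y)) (smul : ∀ (c : ℂ) x, p x → p (c • x))
    (mul : ∀ a ∈ P, ∀ b ∈ Q, p (a * b)) {s : H →L[ℂ] H}
    (hs : s ∈ StarAlgebra.adjoin ℂ ((P : Set (H →L[ℂ] H)) ∪ Q)) : p s := by
  have hstar : ((P : Set (H →L[ℂ] H)) ∪ Q) ∪ star ((P : Set (H →L[ℂ] H)) ∪ Q) =
      (P : Set (H →L[ℂ] H)) ∪ Q := by
    simp
  have h1 : s ∈ Submodule.span ℂ (Submonoid.closure ((P : Set (H →L[ℂ] H)) ∪ Q) :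
      Set (H →L[ℂ] H)) := by
    rw [← Algebra.adjoin_eq_span]
    have h2 : s ∈ (StarAlgebra.adjoin ℂ ((P : Set (H →L[ℂ] H)) ∪ Q)).toSubalgebra := hs
    rwa [StarAlgebra.adjoin_toSubalgebra, hstar] at h2
  have h3 : ∀ x ∈ Submonoid.closure ((P : Set (H →L[ℂ] H)) ∪ Q), ∃ a ∈ P, ∃ b ∈ Q, x = a * b := by
    intro x hx
    induction hx using Submonoid.closure_induction with
    | mem x hx =>
      rcases hx with hx | hx
      · exact ⟨x, hx, 1, one_mem Q, (mul_one x).symm⟩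
      · exact ⟨1, one_mem P, x, hx, (one_mul x).symm⟩
    | one => exact ⟨1, one_mem P, 1, one_mem Q, (one_mul 1).symm⟩
    | mul x y _ _ hx hy =>
      obtain ⟨a, ha, b, hb, rfl⟩ := hx
      obtain ⟨c, hc, d, hd, rfl⟩ := hy
      refine ⟨a * c, mul_mem ha hc, b * d, mul_mem hb hd, ?_⟩
      rw [mul_assoc, ← mul_assoc b, ← hPQ c hc b hb]
      simp only [mul_assoc]
  clear hs
  induction h1 using Submodule.span_induction with
  | mem x hx =>
    obtain ⟨a, ha, b, hb, rfl⟩ := h3 x hx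
    exact mul a ha b hb
  | zero => exact zero
  | add x y _ _ hx hy => exact add x y hx hy
  | smul c x _ hx => exact smul c x hx

/-- A unit vector whose vector state is a product state for `N` and its commutant. -/
structure IsProductVector (N : VonNeumannAlgebra H) (ω : H) : Prop where
  norm_eq : ‖ω‖ = 1
  inner_mul : ∀ n ∈ N, ∀ n' ∈ N.commutant, ⟪ω, n (n' ω)⟫_ℂ = ⟪ω, n ω⟫_ℂ * ⟪ω, n' ω⟫_ℂ

variable {N : VonNeumannAlgebra H} {ω : H}

theorem commutant_apply_comm {n n' : H →L[ℂ] H} (hn : n ∈ N) (hn' : n' ∈ N.commutant) (x : H) :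
    n (n' x) = n' (n x) :=
  DFunLike.congr_fun (VonNeumannAlgebra.mem_commutant_iff.1 hn' n hn) x

theorem IsProductVector.commutant (h : IsProductVector N ω) : IsProductVector N.commutant ω where
  norm_eq := h.norm_eq
  inner_mul n' hn' n hn := by
    rw [VonNeumannAlgebra.commutant_commutant] at hn
    rw [← commutant_apply_comm hn hn', h.inner_mul n hn n' hn', mul_comm]

/-- In tensor terms k and k' lie in the first factor, tensored with ω, and n' acts on the second. -/
theorem IsProductVector.inner_cyclicSubspace (h : IsProductVector N ω) {k k' : H}
    (hk : k ∈ cyclicSubspace N.toStarSubalgebra ω) (hk' : k' ∈ cyclicSubspace N.toStarSubalgebra ω)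
    {n' : H →L[ℂ] H} (hn' : n' ∈ N.commutant) :
    ⟪k, n' k'⟫_ℂ = ⟪k, k'⟫_ℂ * ⟪ω, n' ω⟫_ℂ := by
  refine cyclicSubspace_induction (p := fun k => ⟪k, n' k'⟫_ℂ = ⟪k, k'⟫_ℂ * ⟪ω, n' ω⟫_ℂ)
    (isClosed_eq (by fun_prop) (by fun_prop)) (fun a ha => ?_) hk
  refine cyclicSubspace_induction
    (p := fun k' => ⟪a ω, n' k'⟫_ℂ = ⟪a ω, k'⟫_ℂ * ⟪ω, n' ω⟫_ℂ)
    (isClosed_eq (by fun_prop) (by fun_prop)) (fun b hb => ?_) hk'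
  rw [← star_inner_right, ← star_inner_right, ← commutant_apply_comm hb hn']
  exact h.inner_mul (star a * b) (mul_mem (S := VonNeumannAlgebra H) (star_mem ha) hb) n' hn'

/-- This is ‖nω ⊗ l‖ = ‖nω‖ ‖l‖. In particular nω determines n on the closure of N'ω. -/
theorem IsProductVector.norm_apply (h : IsProductVector N ω) {n : H →L[ℂ] H} (hn : n ∈ N) {l : H}
    (hl : l ∈ cyclicSubspace N.commutant.toStarSubalgebra ω) : ‖n l‖ = ‖n ω‖ * ‖l‖ := by
  have hn2 : star n * n ∈ N.commutant.commutant := by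
    rw [VonNeumannAlgebra.commutant_commutant]
    exact mul_mem (star_mem hn) hn
  have h1 := h.commutant.inner_cyclicSubspace hl hl hn2
  change ⟪l, star n (n l)⟫_ℂ = _ * ⟪ω, star n (n ω)⟫_ℂ at h1
  rw [star_inner_right, star_inner_right, inner_self_eq_norm_sq_to_K, inner_self_eq_norm_sq_to_K,
    inner_self_eq_norm_sq_to_K] at h1
  have h2 : ‖n l‖ ^ 2 = (‖n ω‖ * ‖l‖) ^ 2 := by
    rw [mul_pow, mul_comm]; exact_mod_cast h1
  exact (sq_eq_sq₀ (norm_nonneg _) (by positivity)).1 h2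

/-- Nω is already closed: k and ‖k‖ω have the same vector functional on N', so a contraction
commuting with N', hence in N, carries one to the other. -/
theorem IsProductVector.exists_apply_eq (h : IsProductVector N ω) {k : H}
    (hk : k ∈ cyclicSubspace N.toStarSubalgebra ω) : ∃ n ∈ N, n ω = k := by
  obtain ⟨u, hu, -, huk⟩ := exists_commuting_contraction (S := N.commutant.toStarSubalgebra)
    (η := (‖k‖ : ℂ) • ω) (ζ := k) fun s hs => by
      rw [h.inner_cyclicSubspace hk hk hs, inner_self_eq_norm_sq_to_K, map_smul, inner_smul_left,
        inner_smul_right]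
      simp
      ring
  have huN : u ∈ N := by
    rw [← VonNeumannAlgebra.commutant_commutant N]
    exact VonNeumannAlgebra.mem_commutant_iff.2 hu
  refine ⟨(‖k‖ : ℂ) • u, N.toStarSubalgebra.smul_mem huN _, ?_⟩
  exact (map_smul u _ _).symm.trans huk

/-- The relative commutant `P' ∩ N`. -/
def relativeCommutant (N : VonNeumannAlgebra H) (P : StarSubalgebra ℂ (H →L[ℂ] H)) :
    StarSubalgebra ℂ (H →L[ℂ] H) :=
  N.toStarSubalgebra ⊓ StarSubalgebra.centralizer ℂ (P : Set (H →L[ℂ] H))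

theorem mem_relativeCommutant {P : StarSubalgebra ℂ (H →L[ℂ] H)} {x : H →L[ℂ] H} :
    x ∈ relativeCommutant N P ↔ x ∈ N ∧ ∀ a ∈ P, a * x = x * a := by
  refine and_congr Iff.rfl ((StarSubalgebra.mem_centralizer_iff ℂ).trans ?_)
  exact ⟨fun h a ha => (h a ha).1, fun h a ha => ⟨h a ha, h _ (star_mem ha)⟩⟩

theorem mem_relativeCommutant_of_commute_adjoin {P : StarSubalgebra ℂ (H →L[ℂ] H)} {u : H →L[ℂ] H}
    (hu : ∀ s ∈ StarAlgebra.adjoin ℂ ((P : Set (H →L[ℂ] H)) ∪ N.commutant.toStarSubalgebra),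
      s * u = u * s) : u ∈ relativeCommutant N P := by
  refine mem_relativeCommutant.2 ⟨?_, fun a ha =>
    hu a (StarAlgebra.subset_adjoin ℂ _ (Or.inl ha))⟩
  rw [← VonNeumannAlgebra.commutant_commutant N]
  exact VonNeumannAlgebra.mem_commutant_iff.2 fun b hb =>
    hu b (StarAlgebra.subset_adjoin ℂ _ (Or.inr hb))

theorem inner_apply_selfAdjoint {a : H →L[ℂ] H} (ha : IsSelfAdjoint a) (x y : H) :
    ⟪a x, y⟫_ℂ = ⟪x, a y⟫_ℂ := by
  rw [← star_inner_left, ha.star_eq]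

/-- The real subspaces `P_sa ω` and `i (P' ∩ N)_sa ω` together generate `closure (P ω)`. -/
theorem IsProductVector.eq_zero_of_real_orthogonal (h : IsProductVector N ω)
    {P : StarSubalgebra ℂ (H →L[ℂ] H)} (hP : P ≤ N.toStarSubalgebra) {ξ : H}
    (hξ : ξ ∈ cyclicSubspace P ω) (h1 : ∀ a ∈ P, IsSelfAdjoint a → (⟪a ω, ξ⟫_ℂ).re = 0)
    (h2 : ∀ a ∈ relativeCommutant N P, IsSelfAdjoint a → (⟪a ω, ξ⟫_ℂ).im = 0) : ξ = 0 := by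
  have hω : ω ∈ cyclicSubspace N.toStarSubalgebra ω := self_mem_cyclicSubspace
  have hξN : ξ ∈ cyclicSubspace N.toStarSubalgebra ω := cyclicSubspace_mono hP hξ
  have e1 : ∀ a ∈ P, ⟪ω, a ξ⟫_ℂ + ⟪ξ, a ω⟫_ℂ = 0 := by
    have aux : ∀ a ∈ P, IsSelfAdjoint a → ⟪ω, a ξ⟫_ℂ + ⟪ξ, a ω⟫_ℂ = 0 := fun a ha hsa => by
      rw [← inner_apply_selfAdjoint hsa, ← inner_conj_symm ξ, Complex.add_conj, h1 a ha hsa]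
      simp
    intro a ha
    obtain ⟨b, hb, c, hc, hbs, hcs, rfl⟩ := exists_selfAdjoint_add ha
    have hb' := aux b hb hbs
    have hc' := aux c hc hcs
    simp only [add_apply, smul_apply, inner_add_right, inner_smul_right]
    linear_combination hb' + Complex.I * hc'
  have e2 : ∀ a ∈ relativeCommutant N P, ⟪ω, a ξ⟫_ℂ = ⟪ξ, a ω⟫_ℂ := by
    have aux : ∀ a ∈ relativeCommutant N P, IsSelfAdjoint a → ⟪ω, a ξ⟫_ℂ = ⟪ξ, a ω⟫_ℂ :=
      fun a ha hsa => by
        rw [← inner_apply_selfAdjoint hsa, ← inner_conj_symm ξ]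
        exact (Complex.conj_eq_iff_im.2 (h2 a ha hsa)).symm
    intro a ha
    obtain ⟨b, hb, c, hc, hbs, hcs, rfl⟩ := exists_selfAdjoint_add ha
    simp only [add_apply, smul_apply, inner_add_right, inner_smul_right, aux b hb hbs, aux c hc hcs]
  -- By `e1` and the product property the cross terms cancel, so ω + ξ and ω - ξ have the same
  -- functional on the algebra generated by P and N'. The resulting u lies in P' ∩ N, where `e2`
  -- applies.
  obtain ⟨u, hu, hunorm, huω⟩ := exists_commuting_contraction
    (S := StarAlgebra.adjoin ℂ ((P : Set (H →L[ℂ] H)) ∪ N.commutant.toStarSubalgebra))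
    (η := ω + ξ) (ζ := ω - ξ) fun s hs => by
      have : ⟪ω, s ξ⟫_ℂ + ⟪ξ, s ω⟫_ℂ = 0 := by
        refine adjoin_union_induction (p := fun s => ⟪ω, s ξ⟫_ℂ + ⟪ξ, s ω⟫_ℂ = 0)
          (fun a ha b hb => VonNeumannAlgebra.mem_commutant_iff.1 hb a (hP ha)) ?_ ?_ ?_ ?_ hs
        · simp
        · intro x y hx hy
          simp only [add_apply, inner_add_right]
          linear_combination hx + hy
        · intro c x hx
          simp only [smul_apply, inner_smul_right]
          linear_combination c * hx
        · intro a ha b hb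
          change ⟪ω, a (b ξ)⟫_ℂ + ⟪ξ, a (b ω)⟫_ℂ = 0
          have ha' : star a ∈ N.toStarSubalgebra := hP (star_mem ha)
          rw [← star_inner_left a ω, ← star_inner_left a ξ,
            h.inner_cyclicSubspace (apply_mem_cyclicSubspace ha') hξN hb,
            h.inner_cyclicSubspace (smul_mem_cyclicSubspace ha' hξN) hω hb,
            star_inner_left, star_inner_left, ← add_mul, e1 a ha, zero_mul]
      simp only [map_add, map_sub, inner_add_left, inner_add_right, inner_sub_left, inner_sub_right]
      linear_combination 2 * this
  have huR := mem_relativeCommutant_of_commute_adjoin hu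
  have h3 := e2 u huR
  have h4 : (⟪ω, ξ⟫_ℂ).re = 0 := h1 1 (one_mem P) (IsSelfAdjoint.one _)
  have h5 : (⟪ω, u ω⟫_ℂ).re - (⟪ξ, u ξ⟫_ℂ).re = ‖ω‖ ^ 2 + ‖ξ‖ ^ 2 := by
    have e3 : ⟪ω - ξ, u (ω + ξ)⟫_ℂ = ⟪ω, u ω⟫_ℂ - ⟪ξ, u ξ⟫_ℂ := by
      simp only [map_add, inner_sub_left, inner_add_right]
      linear_combination h3
    have e4 := congrArg Complex.re e3
    rw [huω, inner_self_eq_norm_sq_to_K] at e4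
    have e5 : ‖ω - ξ‖ ^ 2 = ‖ω‖ ^ 2 - 2 * (⟪ω, ξ⟫_ℂ).re + ‖ξ‖ ^ 2 := norm_sub_sq (𝕜 := ℂ) ω ξ
    have e6 : ‖ω - ξ‖ ^ 2 = (⟪ω, u ω⟫_ℂ).re - (⟪ξ, u ξ⟫_ℂ).re := by
      rw [← Complex.sub_re, ← e4]; norm_cast
    rw [← e6, e5, h4]; ring
  have h6 : ‖u ω - ω‖ ^ 2 = ‖u ω‖ ^ 2 - 2 * (⟪ω, u ω⟫_ℂ).re + ‖ω‖ ^ 2 := by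
    rw [norm_sub_rev, norm_sub_sq (𝕜 := ℂ)]
    change ‖ω‖ ^ 2 - 2 * (⟪ω, u ω⟫_ℂ).re + ‖u ω‖ ^ 2 = _
    ring
  have h7 : -(⟪ξ, u ξ⟫_ℂ).re ≤ ‖ξ‖ ^ 2 := by
    have e3 : |(⟪ξ, u ξ⟫_ℂ).re| ≤ ‖ξ‖ * ‖u ξ‖ :=
      (Complex.abs_re_le_norm _).trans (norm_inner_le_norm _ _)
    have e4 : ‖ξ‖ * ‖u ξ‖ ≤ ‖ξ‖ * ‖ξ‖ := by gcongr; exact hunorm ξ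
    have := neg_abs_le (⟪ξ, u ξ⟫_ℂ).re
    nlinarith
  -- `h5` and `h7` give Re⟪ω, uω⟫ ≥ ‖ω‖², the extreme value for a contraction. Since u commutes with
  -- P, it then fixes ξ as well, and `h5` becomes ‖ω‖² - ‖ξ‖² = ‖ω‖² + ‖ξ‖².
  have h8 : u ω = ω := by
    have e3 : ‖u ω‖ ^ 2 ≤ ‖ω‖ ^ 2 := by gcongr; exact hunorm ω
    have e4 : ‖u ω - ω‖ ^ 2 ≤ 0 := by linarith
    have e5 : ‖u ω - ω‖ = 0 := by
      have := le_antisymm e4 (sq_nonneg _)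
      exact pow_eq_zero_iff (two_ne_zero) |>.1 this
    exact sub_eq_zero.1 (norm_eq_zero.1 e5)
  have h9 : u ξ = ξ := by
    refine cyclicSubspace_induction (p := fun x => u x = x) (isClosed_eq (by fun_prop) (by fun_prop))
      (fun a ha => ?_) hξ
    have := DFunLike.congr_fun ((mem_relativeCommutant.1 huR).2 a ha) ω
    change a (u ω) = u (a ω) at this
    rw [← this, h8]
  rw [h8, h9, inner_self_eq_norm_sq_to_K, inner_self_eq_norm_sq_to_K] at h5
  have h10 : ‖ω‖ ^ 2 - ‖ξ‖ ^ 2 = ‖ω‖ ^ 2 + ‖ξ‖ ^ 2 := by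
    rw [← h5]; norm_cast
  exact norm_eq_zero.1 (pow_eq_zero_iff two_ne_zero |>.1 (by linarith : ‖ξ‖ ^ 2 = 0))

/-- The projection onto the closed span of `P N' ω`. -/
theorem IsProductVector.exists_projection (h : IsProductVector N ω)
    {P : StarSubalgebra ℂ (H →L[ℂ] H)} (hP : P ≤ N.toStarSubalgebra) :
    ∃ p ∈ relativeCommutant N P, IsSelfAdjoint p ∧ p ω = ω ∧
      ∀ n ∈ N, p (n ω) ∈ cyclicSubspace P ω := by
  set S := StarAlgebra.adjoin ℂ ((P : Set (H →L[ℂ] H)) ∪ N.commutant.toStarSubalgebra) with hS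
  have hpR : (cyclicSubspace S ω).starProjection ∈ relativeCommutant N P :=
    mem_relativeCommutant_of_commute_adjoin fun s hs => starProjection_cyclicSubspace_commute hs
  refine ⟨_, hpR, isSelfAdjoint_starProjection _,
    Submodule.starProjection_eq_self_iff.2 self_mem_cyclicSubspace, fun n hn => ?_⟩
  set v := (cyclicSubspace S ω).starProjection (n ω) with hv
  have hPS : P ≤ S := fun a ha => StarAlgebra.subset_adjoin ℂ _ (Or.inl ha)
  have hvS : v ∈ cyclicSubspace S ω := Submodule.starProjection_apply_mem _ _
  have hvN : v ∈ cyclicSubspace N.toStarSubalgebra ω :=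
    smul_mem_cyclicSubspace hpR.1 (apply_mem_cyclicSubspace hn)
  -- For a in P and b in N', ⟪w, a b ω⟫ = ⟪w, aω⟫ ⟪ω, bω⟫ = 0. So w is orthogonal to the closed span
  -- of P N' ω, in which it lies.
  set w := v - (cyclicSubspace P ω).starProjection v with hw
  have hvP : (cyclicSubspace P ω).starProjection v ∈ cyclicSubspace P ω :=
    Submodule.starProjection_apply_mem _ _
  have hwN : w ∈ cyclicSubspace N.toStarSubalgebra ω :=
    Submodule.sub_mem _ hvN (cyclicSubspace_mono hP hvP)
  have hwS : w ∈ cyclicSubspace S ω := Submodule.sub_mem _ hvS (cyclicSubspace_mono hPS hvP)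
  have hwP : w ∈ (cyclicSubspace P ω)ᗮ := Submodule.sub_starProjection_mem_orthogonal _
  have hwS' : w ∈ (cyclicSubspace S ω)ᗮ := by
    refine mem_orthogonal_cyclicSubspace fun s hs => ?_
    rw [← inner_conj_symm, map_eq_zero]
    refine adjoin_union_induction (p := fun s => ⟪w, s ω⟫_ℂ = 0)
      (fun a ha b hb => VonNeumannAlgebra.mem_commutant_iff.1 hb a (hP ha)) ?_ ?_ ?_ ?_ hs
    · simp
    · intro x y hx hy
      simp only [add_apply, inner_add_right, hx, hy, add_zero]
    · intro c x hx
      simp only [smul_apply, inner_smul_right, hx, mul_zero]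
    · intro a ha b hb
      change ⟪w, a (b ω)⟫_ℂ = 0
      rw [commutant_apply_comm (hP ha) hb, h.inner_cyclicSubspace hwN
        (apply_mem_cyclicSubspace (hP ha)) hb, (Submodule.mem_orthogonal' _ _).1 hwP _
        (apply_mem_cyclicSubspace ha), zero_mul]
  have hw0 : w = 0 := by
    rw [← inner_self_eq_zero (𝕜 := ℂ)]
    exact (Submodule.mem_orthogonal _ _).1 hwS' w hwS
  rw [sub_eq_zero.1 hw0]
  exact hvP

end ProductVectors

/-! ### Commutation from product vectors -/

section Commutation

open ContinuousLinearMap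

/-- Complex polarization, using v + w and v + iw. -/
theorem inner_eq_zero_of_forall_self {H : Type*} [NormedAddCommGroup H] [InnerProductSpace ℂ H]
    {V : Submodule ℂ H} {C : H →L[ℂ] H}
    (h : ∀ v ∈ V, ⟪v, C v⟫_ℂ = 0) {v w : H} (hv : v ∈ V) (hw : w ∈ V) : ⟪v, C w⟫_ℂ = 0 := by
  have e1 := h _ (V.add_mem hv hw)
  have e2 := h _ (V.add_mem hv (V.smul_mem Complex.I hw))
  simp only [map_add, map_smul, inner_add_left, inner_add_right, inner_smul_left,
    inner_smul_right, Complex.conj_I, h v hv, h w hw] at e1 e2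
  have hI := Complex.I_sq
  linear_combination (1 / 2 : ℂ) * e1 - (Complex.I / 2) * e2 +
    (1 / 2 : ℂ) * (⟪v, C w⟫_ℂ - ⟪w, C v⟫_ℂ) * hI

variable {H : Type*} [NormedAddCommGroup H] [InnerProductSpace ℂ H] [CompleteSpace H]
  {N : VonNeumannAlgebra H} {ω : H}

/-! ### The commutation theorem -/

theorem im_inner_eq_zero {s t : H →L[ℂ] H} (hs : IsSelfAdjoint s) (ht : IsSelfAdjoint t)
    (hst : Commute s t) (ω : H) : (⟪s ω, t ω⟫_ℂ).im = 0 := by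
  rw [← Complex.conj_eq_iff_im, inner_conj_symm, inner_apply_selfAdjoint ht,
    inner_apply_selfAdjoint hs]
  exact congrArg _ (DFunLike.congr_fun hst.eq ω).symm

/-- The vectors `P_sa ω` and `p (P' ∩ N)_sa ω` in `closure (P ω)`. -/
theorem IsProductVector.isRealDualPair (h : IsProductVector N ω)
    {P : StarSubalgebra ℂ (H →L[ℂ] H)} (hP : P ≤ N.toStarSubalgebra) {p : H →L[ℂ] H}
    (hpR : p ∈ relativeCommutant N P) (hp : IsSelfAdjoint p) (hpω : p ω = ω)
    (hpN : ∀ n ∈ N, p (n ω) ∈ cyclicSubspace P ω) :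
    IsRealDualPair {k : cyclicSubspace P ω | ∃ a ∈ P, IsSelfAdjoint a ∧ a ω = k}
      {k : cyclicSubspace P ω | ∃ a ∈ relativeCommutant N P, IsSelfAdjoint a ∧ p (a ω) = k} := by
  have hpa : ∀ a ∈ P, p (a ω) = a ω := fun a ha => by
    have := DFunLike.congr_fun ((mem_relativeCommutant.1 hpR).2 a ha) ω
    change a (p ω) = p (a ω) at this
    rw [← this, hpω]
  have hpk : ∀ k ∈ cyclicSubspace P ω, p k = k := fun k hk =>
    cyclicSubspace_induction (p := fun k => p k = k) (isClosed_eq (by fun_prop) (by fun_prop)) hpa hk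
  refine ⟨?_, ?_, ?_⟩
  · rintro k ⟨a, ha, hsa, hak⟩ k' ⟨b, hb, hsb, hbk⟩
    rw [Submodule.coe_inner, ← hak, ← hbk, ← inner_apply_selfAdjoint hp, hpa a ha]
    exact im_inner_eq_zero hsa hsb ((mem_relativeCommutant.1 hb).2 a ha) ω
  · intro k h1 h2
    refine Subtype.ext (h.eq_zero_of_real_orthogonal hP k.2 (fun a ha hsa => ?_) fun a ha hsa => ?_)
    · exact h1 ⟨a ω, apply_mem_cyclicSubspace ha⟩ ⟨a, ha, hsa, rfl⟩
    · have := h2 ⟨p (a ω), hpN a (mem_relativeCommutant.1 ha).1⟩ ⟨a, ha, hsa, rfl⟩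
      rwa [Submodule.coe_inner, inner_apply_selfAdjoint hp, hpk k k.2] at this
  · intro k hk
    have h1 : (k : H) ∈ (cyclicSubspace P ω)ᗮ := by
      refine mem_orthogonal_cyclicSubspace fun s hs => ?_
      have aux : ∀ a ∈ P, IsSelfAdjoint a → ⟪a ω, (k : H)⟫_ℂ = 0 := fun a ha hsa =>
        hk ⟨a ω, apply_mem_cyclicSubspace ha⟩ ⟨a, ha, hsa, rfl⟩
      obtain ⟨b, hb, c, hc, hbs, hcs, rfl⟩ := exists_selfAdjoint_add hs
      rw [add_apply, smul_apply, inner_add_left, inner_smul_left, aux b hb hbs, aux c hc hcs]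
      simp
    refine Subtype.ext ?_
    rw [ZeroMemClass.coe_zero, ← inner_self_eq_zero (𝕜 := ℂ)]
    exact (Submodule.mem_orthogonal _ _).1 h1 k k.2

/-- A vector `ξ` defines an antilinear map `k ↦ (l ↦ ⟪ξ, k ⊗ l⟫)` between the cyclic subspaces
of a product vector. -/
theorem IsProductVector.exists_antilinear (h : IsProductVector N ω)
    {P Q : StarSubalgebra ℂ (H →L[ℂ] H)} (hP : P ≤ N.toStarSubalgebra)
    (hQ : Q ≤ N.commutant.toStarSubalgebra) (ξ : H) :
    ∃ T : cyclicSubspace P ω →L[ℝ] cyclicSubspace Q ω,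
      (∀ k, T (Complex.I • k) = -(Complex.I • T k)) ∧
      ∀ n ∈ N, ∀ k : cyclicSubspace P ω, n ω = k → ∀ l, ⟪T k, l⟫_ℂ = ⟪ξ, n l⟫_ℂ := by
  have hex : ∀ k : cyclicSubspace P ω, ∃ n ∈ N, n ω = k := fun k =>
    h.exists_apply_eq (cyclicSubspace_mono hP k.2)
  choose n hnN hn using hex
  set T : cyclicSubspace P ω → cyclicSubspace Q ω := fun k =>
    (cyclicSubspace Q ω).orthogonalProjectionOnto (star (n k) ξ) with hT
  have hinner : ∀ k l, ⟪T k, l⟫_ℂ = ⟪ξ, n k l⟫_ℂ := fun k l => by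
    rw [hT, Submodule.inner_orthogonalProjectionOnto_eq_of_mem_right, star_inner_left]
  have key : ∀ m ∈ N, ∀ k : cyclicSubspace P ω, m ω = k → ∀ l, ⟪T k, l⟫_ℂ = ⟪ξ, m l⟫_ℂ := by
    intro m hm k hmk l
    rw [hinner]
    -- Elements of N that agree at ω agree on the closure of N'ω, so the choice of n(k) is
    -- immaterial; this is what makes T additive and antilinear.
    have h1 := h.norm_apply (sub_mem (S := StarSubalgebra ℂ (H →L[ℂ] H)) (hnN k) hm)
      (cyclicSubspace_mono hQ l.2)
    rw [sub_apply, sub_apply, hn, hmk, sub_self, norm_zero, zero_mul, norm_eq_zero, sub_eq_zero] at h1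
    rw [h1]
  have hadd : ∀ k k', T (k + k') = T k + T k' := fun k k' => by
    refine ext_inner_right ℂ fun l => ?_
    rw [key (n k + n k') (add_mem (S := StarSubalgebra ℂ (H →L[ℂ] H)) (hnN k) (hnN k')) (k + k')
      (by rw [add_apply, hn, hn]; rfl), inner_add_left, hinner, hinner, add_apply, inner_add_right]
  have hsmul : ∀ (c : ℂ) k, T (c • k) = (starRingEnd ℂ c) • T k := fun c k => by
    refine ext_inner_right ℂ fun l => ?_
    rw [key (c • n k) (N.toStarSubalgebra.smul_mem (hnN k) c) (c • k)
      (by rw [smul_apply, hn]; rfl), inner_smul_left, hinner, smul_apply, inner_smul_right]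
    simp
  have hbound : ∀ k, ‖T k‖ ≤ ‖ξ‖ * ‖k‖ := fun k => by
    have h1 : ‖T k‖ * ‖T k‖ ≤ ‖ξ‖ * ‖k‖ * ‖T k‖ := by
      calc ‖T k‖ * ‖T k‖ = ‖⟪T k, T k⟫_ℂ‖ := by
            rw [inner_self_eq_norm_sq_to_K]; simp [sq]
        _ ≤ ‖ξ‖ * ‖n k (T k)‖ := by rw [hinner]; exact norm_inner_le_norm _ _
        _ = ‖ξ‖ * ‖k‖ * ‖T k‖ := by
            rw [h.norm_apply (hnN k) (cyclicSubspace_mono hQ (T k).2), hn]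
            simp [mul_assoc]
    rcases eq_or_lt_of_le (norm_nonneg (T k)) with h0 | h0
    · rw [← h0]; positivity
    · exact le_of_mul_le_mul_right h1 h0
  refine ⟨LinearMap.mkContinuous
    { toFun := T
      map_add' := hadd
      map_smul' := fun r k => ?_ } ‖ξ‖ hbound, fun k => ?_, key⟩
  · rw [RingHom.id_apply, ← Complex.coe_smul, hsmul, Complex.conj_ofReal, Complex.coe_smul]
  · change T _ = -(Complex.I • T k)
    rw [hsmul, Complex.conj_I, neg_smul]

/-- The two orthogonality conditions are those under which the antilinear map of ξ vanishes. As p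
and q fix ξ, vanishing on the two cyclic subspaces already gives ξ ⊥ N N' ω, which is total. -/
theorem IsProductVector.eq_zero_of_orthogonal (h : IsProductVector N ω)
    (htot : ∀ x, (∀ n ∈ N, ∀ n' ∈ N.commutant, ⟪x, n (n' ω)⟫_ℂ = 0) → x = 0)
    {P Q : StarSubalgebra ℂ (H →L[ℂ] H)} (hP : P ≤ N.toStarSubalgebra)
    (hQ : Q ≤ N.commutant.toStarSubalgebra) {p q : H →L[ℂ] H}
    (hpR : p ∈ relativeCommutant N P) (hp : IsSelfAdjoint p) (hpω : p ω = ω)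
    (hpN : ∀ n ∈ N, p (n ω) ∈ cyclicSubspace P ω)
    (hqR : q ∈ relativeCommutant N.commutant Q) (hq : IsSelfAdjoint q) (hqω : q ω = ω)
    (hqN : ∀ n ∈ N.commutant, q (n ω) ∈ cyclicSubspace Q ω)
    {ξ : H} (hpξ : p ξ = ξ) (hqξ : q ξ = ξ)
    (h1 : ∀ a ∈ P, ∀ b ∈ Q, IsSelfAdjoint a → IsSelfAdjoint b → (⟪ξ, a (b ω)⟫_ℂ).re = 0)
    (h2 : ∀ a ∈ relativeCommutant N P, ∀ b ∈ relativeCommutant N.commutant Q,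
      IsSelfAdjoint a → IsSelfAdjoint b → (⟪ξ, a (b ω)⟫_ℂ).im = 0) : ξ = 0 := by
  obtain ⟨T, hTI, hT⟩ := h.exists_antilinear hP hQ ξ
  have hpN' := (mem_relativeCommutant.1 hpR).1
  have hqN' := (mem_relativeCommutant.1 hqR).1
  have hpq : ∀ n ∈ N, ∀ n' ∈ N.commutant, ⟪ξ, p (n (q (n' ω)))⟫_ℂ = ⟪ξ, n (n' ω)⟫_ℂ := by
    intro n hn n' _
    rw [← inner_apply_selfAdjoint hp, hpξ, commutant_apply_comm hn hqN',
      ← inner_apply_selfAdjoint hq, hqξ]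
  have hT0 : T = 0 := by
    refine (h.isRealDualPair hP hpR hp hpω hpN).antilinear_eq_zero
      (h.commutant.isRealDualPair hQ hqR hq hqω hqN) T hTI ?_ ?_
    · rintro k ⟨a, ha, hsa, hak⟩ l ⟨b, hb, hsb, hbl⟩
      rw [hT a (hP ha) k hak, ← hbl]
      exact h1 a ha b hb hsa hsb
    · rintro k ⟨a, ha, hsa, hak⟩ l ⟨b, hb, hsb, hbl⟩
      have haN := (mem_relativeCommutant.1 ha).1
      rw [hT (p * a) (mul_mem hpN' haN) k hak, ← hbl]
      change (⟪ξ, p (a (q (b ω)))⟫_ℂ).im = 0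
      rw [hpq a haN b (mem_relativeCommutant.1 hb).1]
      exact h2 a ha b hb hsa hsb
  refine htot ξ fun n hn n' hn' => ?_
  rw [← hpq n hn n' hn']
  have := hT (p * n) (mul_mem hpN' hn) ⟨p (n ω), hpN n hn⟩ rfl ⟨q (n' ω), hqN n' hn'⟩
  rw [hT0] at this
  simpa using this.symm

section

attribute [local instance] InnerProductSpace.complexToReal

/-- The vector yω lies in the closed real span of P_sa Q_sa ω, and xω has real inner products with
that span because x commutes with P and Q. -/
theorem IsProductVector.im_inner_commutant (h : IsProductVector N ω)
    (htot : ∀ x, (∀ n ∈ N, ∀ n' ∈ N.commutant, ⟪x, n (n' ω)⟫_ℂ = 0) → x = 0)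
    {P Q : StarSubalgebra ℂ (H →L[ℂ] H)} (hP : P ≤ N.toStarSubalgebra)
    (hQ : Q ≤ N.commutant.toStarSubalgebra) {x y : H →L[ℂ] H} (hx : IsSelfAdjoint x)
    (hy : IsSelfAdjoint y) (hxP : ∀ a ∈ P, a * x = x * a) (hxQ : ∀ b ∈ Q, b * x = x * b)
    (hyP : ∀ a ∈ relativeCommutant N P, a * y = y * a)
    (hyQ : ∀ b ∈ relativeCommutant N.commutant Q, b * y = y * b) :
    (⟪x ω, y ω⟫_ℂ).im = 0 := by
  obtain ⟨p, hpR, hp, hpω, hpN⟩ := h.exists_projection hP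
  obtain ⟨q, hqR, hq, hqω, hqN⟩ := h.commutant.exists_projection hQ
  have hcomm : ∀ a ∈ N, ∀ b ∈ N.commutant, Commute a b := fun a ha b hb =>
    VonNeumannAlgebra.mem_commutant_iff.1 hb a ha
  set E : Submodule ℝ H := (Submodule.span ℝ {v | ∃ a ∈ P, ∃ b ∈ Q, IsSelfAdjoint a ∧
    IsSelfAdjoint b ∧ a (b ω) = v}).topologicalClosure with hE
  have : CompleteSpace E := (Submodule.isClosed_topologicalClosure _).completeSpace_coe
  have hEle : ∀ F : Submodule ℝ H, IsClosed (F : Set H) →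
      (∀ a ∈ P, ∀ b ∈ Q, IsSelfAdjoint a → IsSelfAdjoint b → a (b ω) ∈ F) → E ≤ F := by
    intro F hF hgen
    refine Submodule.topologicalClosure_minimal _ (Submodule.span_le.2 ?_) hF
    rintro _ ⟨a, ha, b, hb, hsa, hsb, rfl⟩
    exact hgen a ha b hb hsa hsb
  have hEim : ∀ z : H →L[ℂ] H, IsSelfAdjoint z → (∀ a ∈ P, Commute a z) → (∀ b ∈ Q, Commute b z) →
      ∀ e ∈ E, (⟪z ω, e⟫_ℂ).im = 0 := by
    intro z hz hzP hzQ e he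
    have hle : E ≤ (Submodule.span ℝ {mulI H (z ω)})ᗮ := by
      refine hEle _ (Submodule.isClosed_orthogonal _) fun a ha b hb hsa hsb => ?_
      refine mem_orthogonal_span.2 ?_
      rintro _ rfl
      rw [real_inner_mulI_left]
      exact im_inner_eq_zero hz ((hsa.commute_iff hsb).1 (hcomm a (hP ha) b (hQ hb)))
        ((hzP a ha).symm.mul_right (hzQ b hb).symm) ω
    rw [← real_inner_mulI_left]
    exact mem_orthogonal_span.1 (hle he) _ rfl
  have hEfix : ∀ r : H →L[ℂ] H, r ω = ω → (∀ a ∈ P, Commute a r) → (∀ b ∈ Q, Commute b r) →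
      ∀ e ∈ E, r e = e := by
    intro r hr hrP hrQ e he
    have hle : E ≤ ((r - 1 : H →L[ℂ] H).restrictScalars ℝ).ker := by
      refine hEle _ (ContinuousLinearMap.isClosed_ker _) fun a ha b hb _ _ => ?_
      have := DFunLike.congr_fun ((hrP a ha).mul_left (hrQ b hb)).eq ω
      change a (b (r ω)) = r (a (b ω)) at this
      rw [LinearMap.mem_ker]
      change r (a (b ω)) - a (b ω) = 0
      rw [← this, hr, sub_self]
    exact sub_eq_zero.1 (LinearMap.mem_ker.1 (hle he))
  have hRP : ∀ r ∈ relativeCommutant N P, (∀ a ∈ P, Commute a r) ∧ ∀ b ∈ Q, Commute b r :=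
    fun r hr => ⟨fun a ha => (mem_relativeCommutant.1 hr).2 a ha,
      fun b hb => (hcomm r (mem_relativeCommutant.1 hr).1 b (hQ hb)).symm⟩
  have hRQ : ∀ r ∈ relativeCommutant N.commutant Q, (∀ a ∈ P, Commute a r) ∧ ∀ b ∈ Q, Commute b r :=
    fun r hr => ⟨fun a ha => hcomm a (hP ha) r (mem_relativeCommutant.1 hr).1,
      fun b hb => (mem_relativeCommutant.1 hr).2 b hb⟩
  have hyfix : ∀ r : H →L[ℂ] H, r ω = ω → r * y = y * r → r (y ω) = y ω := fun r hr hry => by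
    have := DFunLike.congr_fun hry ω
    change r (y ω) = y (r ω) at this
    rw [this, hr]
  -- Both terms are fixed by p and q and have real inner products with (P' ∩ N)_sa (Q' ∩ N')_sa ω; ξ
  -- itself is real-orthogonal to P_sa Q_sa ω.
  set ξ := y ω - E.starProjection (y ω) with hξ
  have hEmem : E.starProjection (y ω) ∈ E := Submodule.starProjection_apply_mem _ _
  have hξ0 : ξ = 0 := by
    refine h.eq_zero_of_orthogonal htot hP hQ hpR hp hpω hpN hqR hq hqω hqN ?_ ?_ ?_ ?_
    · rw [hξ, map_sub, hyfix p hpω (hyP p hpR), hEfix p hpω (hRP p hpR).1 (hRP p hpR).2 _ hEmem]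
    · rw [hξ, map_sub, hyfix q hqω (hyQ q hqR), hEfix q hqω (hRQ q hqR).1 (hRQ q hqR).2 _ hEmem]
    · intro a ha b hb hsa hsb
      exact (Submodule.mem_orthogonal' _ _).1 (Submodule.sub_starProjection_mem_orthogonal (y ω)) _
        (Submodule.le_topologicalClosure _ (Submodule.subset_span ⟨a, ha, b, hb, hsa, hsb, rfl⟩))
    · intro a ha b hb hsa hsb
      have hab : IsSelfAdjoint (a * b) := (hsa.commute_iff hsb).1
        (hcomm a (mem_relativeCommutant.1 ha).1 b (mem_relativeCommutant.1 hb).1)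
      have h3 : (⟪y ω, a (b ω)⟫_ℂ).im = 0 :=
        im_inner_eq_zero hy hab ((Commute.mul_left (hyP a ha) (hyQ b hb)).symm) ω
      have h4 := hEim (a * b) hab (fun c hc => ((hRP a ha).1 c hc).mul_right ((hRQ b hb).1 c hc))
        (fun c hc => ((hRP a ha).2 c hc).mul_right ((hRQ b hb).2 c hc)) _ hEmem
      change (⟪a (b ω), _⟫_ℂ).im = 0 at h4
      rw [← inner_conj_symm, Complex.conj_im, neg_eq_zero] at h4
      rw [hξ, inner_sub_left, Complex.sub_im, h3, h4, sub_zero]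
  rw [sub_eq_zero.1 hξ0]
  exact hEim x hx hxP hxQ _ hEmem

end

/-- The projection onto the closed span of N N' ω lies in N ∩ N', so it is scalar, and it fixes ω ≠
0. -/
theorem IsFactor.total_of_ne_zero (hN : IsFactor N) (hω : ω ≠ 0) (x : H)
    (hx : ∀ n ∈ N, ∀ n' ∈ N.commutant, ⟪x, n (n' ω)⟫_ℂ = 0) : x = 0 := by
  set S := StarAlgebra.adjoin ℂ ((N.toStarSubalgebra : Set (H →L[ℂ] H)) ∪
    N.commutant.toStarSubalgebra) with hS
  have hpR : (cyclicSubspace S ω).starProjection ∈ relativeCommutant N N.toStarSubalgebra :=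
    mem_relativeCommutant_of_commute_adjoin fun s hs => starProjection_cyclicSubspace_commute hs
  obtain ⟨c, hc⟩ := hN _ (mem_relativeCommutant.1 hpR).1
    (VonNeumannAlgebra.mem_commutant_iff.2 (mem_relativeCommutant.1 hpR).2)
  have h1 : (cyclicSubspace S ω).starProjection ω = ω :=
    Submodule.starProjection_eq_self_iff.2 self_mem_cyclicSubspace
  have hxS : x ∈ (cyclicSubspace S ω)ᗮ := by
    refine mem_orthogonal_cyclicSubspace fun s hs => ?_
    rw [← inner_conj_symm, map_eq_zero]
    refine adjoin_union_induction (p := fun s => ⟪x, s ω⟫_ℂ = 0)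
      (fun a ha b hb => VonNeumannAlgebra.mem_commutant_iff.1 hb a ha) ?_ ?_ ?_ hx hs
    · simp
    · intro s t hs ht
      simp only [add_apply, inner_add_right, hs, ht, add_zero]
    · intro c s hs
      simp only [smul_apply, inner_smul_right, hs, mul_zero]
  have h2 := (Submodule.starProjection_apply_eq_zero_iff _).2 hxS
  rw [hc] at h1 h2
  have hc0 : c ≠ 0 := by
    rintro rfl
    simp at h1
    exact hω h1.symm
  simpa [hc0] using h2

theorem IsProductVector.normalize (h : IsProductVector N ω) {n n' : H →L[ℂ] H} (hn : n ∈ N)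
    (hn' : n' ∈ N.commutant) (h0 : n (n' ω) ≠ 0) :
    IsProductVector N ((‖n (n' ω)‖⁻¹ : ℂ) • n (n' ω)) := by
  have hr : ‖n (n' ω)‖ ≠ 0 := norm_ne_zero_iff.2 h0
  have key : ∀ a ∈ N, ∀ a' ∈ N.commutant, ⟪n (n' ω), a (a' (n (n' ω)))⟫_ℂ =
      ⟪n ω, a (n ω)⟫_ℂ * ⟪n' ω, a' (n' ω)⟫_ℂ := by
    intro a ha a' ha'
    have e := h.inner_mul (star n * a * n) (mul_mem (mul_mem (star_mem hn) ha) hn)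
      (star n' * a' * n') (mul_mem (mul_mem (star_mem hn') ha') hn')
    change ⟪ω, (star n * a * n) (star n' (a' (n' ω)))⟫_ℂ =
      ⟪ω, star n (a (n ω))⟫_ℂ * ⟪ω, star n' (a' (n' ω))⟫_ℂ at e
    rw [commutant_apply_comm (mul_mem (mul_mem (star_mem hn) ha) hn) (star_mem hn')] at e
    change ⟪ω, star n' (star n (a (n (a' (n' ω)))))⟫_ℂ = _ at e
    rw [star_inner_right, star_inner_right, star_inner_right, star_inner_right] at e
    rw [← commutant_apply_comm hn ha', e]
  have key1 : ∀ a ∈ N, ⟪n (n' ω), a (n (n' ω))⟫_ℂ = ⟪n ω, a (n ω)⟫_ℂ * ⟪n' ω, n' ω⟫_ℂ :=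
    fun a ha => key a ha 1 (one_mem _)
  have key2 : ∀ a' ∈ N.commutant, ⟪n (n' ω), a' (n (n' ω))⟫_ℂ =
      ⟪n ω, n ω⟫_ℂ * ⟪n' ω, a' (n' ω)⟫_ℂ := fun a' ha' => key 1 (one_mem _) a' ha'
  have key3 : ((‖n (n' ω)‖ : ℂ)) ^ 2 = ⟪n ω, n ω⟫_ℂ * ⟪n' ω, n' ω⟫_ℂ := by
    exact (inner_self_eq_norm_sq_to_K (𝕜 := ℂ) _).symm.trans (key 1 (one_mem _) 1 (one_mem _))
  have hrC : (‖n (n' ω)‖ : ℂ) ≠ 0 := by exact_mod_cast hr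
  refine ⟨?_, fun a ha a' ha' => ?_⟩
  · rw [norm_smul, norm_inv, Complex.norm_real, norm_norm, inv_mul_cancel₀ hr]
  · simp only [map_smul, inner_smul_left, inner_smul_right, key a ha a' ha', key1 a ha,
      key2 a' ha', map_inv₀, Complex.conj_ofReal]
    field_simp
    rw [key3]
    ring

/-- **Commutation theorem.** For `P ⊆ N` and `Q ⊆ N'`, where `N` is a factor with a product
vector, the commutant of `P ∪ Q` is generated by the relative commutants `P' ∩ N` and
`Q' ∩ N'`. -/
theorem IsProductVector.commute (hN : IsFactor N) (h : IsProductVector N ω)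
    {P Q : StarSubalgebra ℂ (H →L[ℂ] H)} (hP : P ≤ N.toStarSubalgebra)
    (hQ : Q ≤ N.commutant.toStarSubalgebra) {x y : H →L[ℂ] H}
    (hxP : ∀ a ∈ P, a * x = x * a) (hxQ : ∀ b ∈ Q, b * x = x * b)
    (hyP : ∀ a ∈ relativeCommutant N P, a * y = y * a)
    (hyQ : ∀ b ∈ relativeCommutant N.commutant Q, b * y = y * b) : Commute x y := by
  have hω : ω ≠ 0 := norm_ne_zero_iff.1 (by rw [h.norm_eq]; exact one_ne_zero)
  have mem_centralizer : ∀ {A B : StarSubalgebra ℂ (H →L[ℂ] H)} {z : H →L[ℂ] H},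
      z ∈ StarSubalgebra.centralizer ℂ ((A : Set (H →L[ℂ] H)) ∪ B) ↔
        (∀ a ∈ A, a * z = z * a) ∧ ∀ b ∈ B, b * z = z * b := by
    intro A B z
    rw [StarSubalgebra.mem_centralizer_iff]
    refine ⟨fun hz => ⟨fun a ha => (hz a (Or.inl ha)).1, fun b hb => (hz b (Or.inr hb)).1⟩, ?_⟩
    rintro ⟨h1, h2⟩ g (hg | hg)
    · exact ⟨h1 g hg, h1 _ (star_mem hg)⟩
    · exact ⟨h2 g hg, h2 _ (star_mem hg)⟩
  have main : ∀ x ∈ StarSubalgebra.centralizer ℂ ((P : Set (H →L[ℂ] H)) ∪ Q),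
      ∀ y ∈ StarSubalgebra.centralizer ℂ ((relativeCommutant N P : Set (H →L[ℂ] H)) ∪
        relativeCommutant N.commutant Q), IsSelfAdjoint x → IsSelfAdjoint y → Commute x y := by
    intro x hx y hy hxs hys
    rw [mem_centralizer] at hx hy
    set C := x * y - y * x with hC
    have h1 : ∀ n ∈ N, ∀ n' ∈ N.commutant, ⟪n (n' ω), C (n (n' ω))⟫_ℂ = 0 := by
      intro n hn n' hn'
      by_cases h0 : n (n' ω) = 0
      · rw [h0, inner_zero_left]
      have hprod := h.normalize hn hn' h0
      set ω' := (‖n (n' ω)‖⁻¹ : ℂ) • n (n' ω) with hω'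
      have hne : ω' ≠ 0 := norm_ne_zero_iff.1 (by rw [hprod.norm_eq]; exact one_ne_zero)
      have him := hprod.im_inner_commutant (hN.total_of_ne_zero hne) hP hQ hxs hys
        hx.1 hx.2 hy.1 hy.2
      have e1 : ⟪ω', C ω'⟫_ℂ = 0 := by
        change ⟪ω', x (y ω') - y (x ω')⟫_ℂ = 0
        rw [inner_sub_right, ← inner_apply_selfAdjoint hxs ω', ← inner_apply_selfAdjoint hys ω',
          ← inner_conj_symm (y ω'), Complex.conj_eq_iff_im.2 him, sub_self]
      have hr : (‖n (n' ω)‖ : ℂ) ≠ 0 := by exact_mod_cast norm_ne_zero_iff.2 h0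
      rw [hω', map_smul, inner_smul_left, inner_smul_right, map_inv₀, Complex.conj_ofReal] at e1
      simpa [hr] using e1
    -- The vectors n n' ω do not form a subspace, so polarization is done first in n and then in n'.
    have orb : ∀ (M : VonNeumannAlgebra H) (D : H →L[ℂ] H),
        (∀ m ∈ M, ⟪m ω, D (m ω)⟫_ℂ = 0) → ∀ m ∈ M, ∀ k ∈ M, ⟪m ω, D (k ω)⟫_ℂ = 0 := by
      intro M D hD m hm k hk
      refine inner_eq_zero_of_forall_self (V := M.toStarSubalgebra.toSubalgebra.toSubmodule.map
        (ContinuousLinearMap.apply ℂ H ω).toLinearMap) ?_ ⟨m, hm, rfl⟩ ⟨k, hk, rfl⟩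
      rintro _ ⟨a, ha, rfl⟩
      exact hD a ha
    have h2 : ∀ n ∈ N, ∀ m ∈ N, ∀ n' ∈ N.commutant, ⟪n (n' ω), C (m (n' ω))⟫_ℂ = 0 := by
      intro n hn m hm n' hn'
      have := orb N (star n' * C * n') (fun k hk => ?_) n hn m hm
      · change ⟪n ω, star n' (C (n' (m ω)))⟫_ℂ = 0 at this
        rwa [star_inner_right, ← commutant_apply_comm hn hn', ← commutant_apply_comm hm hn'] at this
      · change ⟪k ω, star n' (C (n' (k ω)))⟫_ℂ = 0
        rw [star_inner_right, ← commutant_apply_comm hk hn']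
        exact h1 k hk n' hn'
    have h3 : ∀ n ∈ N, ∀ m ∈ N, ∀ n' ∈ N.commutant, ∀ m' ∈ N.commutant,
        ⟪n (n' ω), C (m (m' ω))⟫_ℂ = 0 := by
      intro n hn m hm n' hn' m' hm'
      have := orb N.commutant (star n * C * m) (fun k hk => ?_) n' hn' m' hm'
      · change ⟪n' ω, star n (C (m (m' ω)))⟫_ℂ = 0 at this
        rwa [star_inner_right] at this
      · change ⟪k ω, star n (C (m (k ω)))⟫_ℂ = 0
        rw [star_inner_right]
        exact h2 n hn m hm k hk
    have tot := hN.total_of_ne_zero hω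
    have h4 : ∀ m ∈ N, ∀ m' ∈ N.commutant, C (m (m' ω)) = 0 := fun m hm m' hm' =>
      tot _ fun n hn n' hn' => by
        rw [← inner_conj_symm, h3 n hn m hm n' hn' m' hm', map_zero]
    have h5 : star C = 0 := by
      ext v
      refine tot _ fun n hn n' hn' => ?_
      rw [star_inner_left, h4 n hn n' hn', inner_zero_right]
    exact sub_eq_zero.1 (star_eq_zero.1 h5)
  obtain ⟨b, hb, c, hc, hbs, hcs, rfl⟩ := exists_selfAdjoint_add
    (mem_centralizer.2 ⟨hxP, hxQ⟩)
  obtain ⟨b', hb', c', hc', hbs', hcs', rfl⟩ := exists_selfAdjoint_add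
    (mem_centralizer.2 ⟨hyP, hyQ⟩)
  have e1 := main b hb b' hb' hbs hbs'
  have e2 := main b hb c' hc' hbs hcs'
  have e3 := main c hc b' hb' hcs hbs'
  have e4 := main c hc c' hc' hcs hcs'
  exact (e1.add_right (e2.smul_right _)).add_left ((e3.add_right (e4.smul_right _)).smul_left _)

/-- The relative double commutant of a von Neumann subalgebra of `N`. -/
theorem IsProductVector.mem_of_commute_relativeCommutant (hN : IsFactor N)
    (h : IsProductVector N ω) {M : VonNeumannAlgebra H} (hM : M ≤ N) {y : H →L[ℂ] H} (hy : y ∈ N)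
    (hyM : ∀ a ∈ relativeCommutant N M.toStarSubalgebra, a * y = y * a) : y ∈ M := by
  rw [← VonNeumannAlgebra.commutant_commutant M]
  refine VonNeumannAlgebra.mem_commutant_iff.2 fun z hz => ?_
  -- With Q the scalars, Q' ∩ N' is all of N', which commutes with y in N.
  refine h.commute hN (P := M.toStarSubalgebra) (Q := ⊥) hM bot_le
    (fun a ha => VonNeumannAlgebra.mem_commutant_iff.1 hz a ha) (fun b hb => ?_) hyM fun b hb => ?_
  · obtain ⟨c, rfl⟩ := StarSubalgebra.mem_bot.1 hb
    exact Algebra.commutes c z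
  · exact (VonNeumannAlgebra.mem_commutant_iff.1 (mem_relativeCommutant.1 hb).1 y hy).symm

/-- A unit vector in the range of a minimal projection e works: e n e = c e pulls n out as a scalar,
and n' preserves that range. -/
theorem IsTypeIFactor.exists_isProductVector (hN : IsTypeIFactor N) :
    ∃ ω, IsProductVector N ω := by
  obtain ⟨-, e, he, hproj, hne, hmin⟩ := hN
  obtain ⟨v, hv⟩ : ∃ v, e v ≠ 0 := by
    by_contra! hall
    exact hne (ContinuousLinearMap.ext hall)
  have hr : (‖e v‖ : ℂ) ≠ 0 := by exact_mod_cast norm_ne_zero_iff.2 hv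
  set ω := (‖e v‖⁻¹ : ℂ) • e v with hω
  have heω : e ω = ω := by
    have := DFunLike.congr_fun hproj.isIdempotentElem.eq v
    change e (e v) = e v at this
    rw [hω, map_smul, this]
  have hnorm : ‖ω‖ = 1 := by
    rw [hω, norm_smul, norm_inv, Complex.norm_real, norm_norm,
      inv_mul_cancel₀ (norm_ne_zero_iff.2 hv)]
  have hsa : IsSelfAdjoint e := hproj.isSelfAdjoint
  have hωω : ⟪ω, ω⟫_ℂ = 1 := by
    rw [inner_self_eq_norm_sq_to_K, hnorm]; simp
  refine ⟨ω, hnorm, fun n hn n' hn' => ?_⟩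
  obtain ⟨c, hc⟩ := hmin n hn
  have key : ∀ x, e x = x → ⟪ω, n x⟫_ℂ = c * ⟪ω, x⟫_ℂ := fun x hx => by
    have := DFunLike.congr_fun hc x
    change e (n (e x)) = c • e x at this
    rw [hx] at this
    rw [← inner_smul_right, ← this, ← inner_apply_selfAdjoint hsa, heω]
  rw [key ω heω, key (n' ω) (by rw [commutant_apply_comm he hn', heω]), hωω, mul_one]

end Commutation

section Net

variable {d : ℕ}

/-! ### Observables at a bond -/

/-- Exchange the values `i` and `j` at the bond `b`. -/
def swapAt (b : Bond) (i j : Fin d) : Equiv.Perm (Bond → Fin d) :=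
  Function.Involutive.toPerm (fun s => Function.update s b (Equiv.swap i j (s b))) fun s => by
    simp

theorem swapAt_apply (b : Bond) (i j : Fin d) (s : Bond → Fin d) :
    swapAt b i j s = Function.update s b (Equiv.swap i j (s b)) := rfl

theorem star_bondUnit (b : Bond) (i j : Fin d) : star (bondUnit b i j) = bondUnit b j i := by
  refine ContinuousLinearMap.ext fun ψ => ext_inner_right ℂ fun φ => ?_
  -- Exchanging i and j at b pairs the configurations on which the two matrix units are supported.
  rw [star_inner_left, lp.inner_eq_tsum, lp.inner_eq_tsum, ← (swapAt b i j).tsum_eq]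
  refine tsum_congr fun s => ?_
  rw [bondUnit_apply, bondUnit_apply, swapAt_apply]
  by_cases h : s b = j
  · subst h
    simp
  · have h' : Equiv.swap i j (s b) ≠ i := fun h' => h (by
      rw [← Equiv.swap_apply_left i j] at h'
      have := congrArg (Equiv.swap i j) h'
      simpa using this)
    simp [h, h']

theorem star_bondOp (b : Bond) (M : Matrix (Fin d) (Fin d) ℂ) :
    star (bondOp b M) = bondOp b M.conjTranspose := by
  simp only [bondOp, star_sum, star_smul, star_bondUnit, Matrix.conjTranspose_apply]
  exact Finset.sum_comm

theorem bondOp_commute {b b' : Bond} (hb : b ≠ b') (M M' : Matrix (Fin d) (Fin d) ℂ) :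
    Commute (bondOp b M) (bondOp b' M') := by
  refine ContinuousLinearMap.ext fun ψ => lp.ext (funext fun s => ?_)
  change bondOp b M (bondOp b' M' ψ) s = bondOp b' M' (bondOp b M ψ) s
  simp only [bondOp_apply, Finset.mul_sum, Function.update_of_ne hb, Function.update_of_ne hb.symm]
  rw [Finset.sum_comm]
  refine Finset.sum_congr rfl fun k _ => Finset.sum_congr rfl fun j _ => ?_
  rw [Function.update_comm hb]
  ring

theorem localAlgebra_le_regionAlgebra {Λ : Set Bond} {F : Finset Bond} (hF : (F : Set Bond) ⊆ Λ) :
    localAlgebra d F ≤ regionAlgebra d Λ :=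
  (le_iSup (fun F : {F : Finset Bond // (F : Set Bond) ⊆ Λ} => localAlgebra d F.1) ⟨F, hF⟩).trans
    (StarSubalgebra.le_topologicalClosure _)

theorem bondOp_mem_regionAlgebra {Λ : Set Bond} {b : Bond} (hb : b ∈ Λ)
    (M : Matrix (Fin d) (Fin d) ℂ) : bondOp b M ∈ regionAlgebra d Λ :=
  localAlgebra_le_regionAlgebra (F := {b}) (by simpa using hb)
    (StarAlgebra.subset_adjoin ℂ _ ⟨b, Finset.mem_singleton_self b, M, rfl⟩)

/-- The matrix `M` at the bond `b` as an element of the quasi-local algebra. -/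
def bondObservable (b : Bond) (M : Matrix (Fin d) (Fin d) ℂ) : QuasiLocal d :=
  ⟨bondOp b M, bondOp_mem_regionAlgebra (Set.mem_univ b) M⟩

theorem star_bondObservable (b : Bond) (M : Matrix (Fin d) (Fin d) ℂ) :
    star (bondObservable b M) = bondObservable b M.conjTranspose :=
  Subtype.ext (star_bondOp b M)

theorem bondObservable_commute {b b' : Bond} (hb : b ≠ b') (M M' : Matrix (Fin d) (Fin d) ℂ) :
    Commute (bondObservable b M) (bondObservable b' M') :=
  Subtype.ext (bondOp_commute hb M M').eq

/-- Closedness makes the quasi-local algebra a C⋆-algebra, so that representations are contractive.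
-/
instance : IsClosed (regionAlgebra d Set.univ : Set (ConfigSpace d →L[ℂ] ConfigSpace d)) :=
  StarSubalgebra.isClosed_topologicalClosure _

/-! ### The net of von Neumann algebras -/

variable {H : Type*} [NormedAddCommGroup H] [InnerProductSpace ℂ H] [CompleteSpace H]
  {π₀ : QuasiLocal d →⋆ₐ[ℂ] (H →L[ℂ] H)} {Λ Λ' : Set Bond}

theorem continuous_rep (π₀ : QuasiLocal d →⋆ₐ[ℂ] (H →L[ℂ] H)) : Continuous π₀ :=
  AddMonoidHomClass.continuous_of_bound π₀ 1 fun a => by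
    simpa only [one_mul] using NonUnitalStarAlgHom.norm_apply_le π₀ a

theorem rep_commute_of_bondObservable {z : H →L[ℂ] H}
    (hz : ∀ b ∈ Λ, ∀ M, Commute (π₀ (bondObservable b M)) z) {a : QuasiLocal d}
    (ha : (a : ConfigSpace d →L[ℂ] ConfigSpace d) ∈ regionAlgebra d Λ) : Commute (π₀ a) z := by
  -- The elements whose image commutes with z and `star z` form a closed star subalgebra. It
  -- contains the generators, as matrices at a bond are closed under adjoints.
  set C : StarSubalgebra ℂ (QuasiLocal d) := (StarSubalgebra.centralizer ℂ {z}).comap π₀ with hC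
  have hCmem : ∀ a, a ∈ C ↔ Commute (π₀ a) z ∧ Commute (π₀ a) (star z) := fun a => by
    rw [hC, StarSubalgebra.mem_comap, StarSubalgebra.mem_centralizer_iff]
    simp only [Set.mem_singleton_iff, forall_eq]
    exact and_congr eq_comm eq_comm
  have hCclosed : IsClosed (C : Set (QuasiLocal d)) := by
    have : (C : Set (QuasiLocal d)) =
        {a | π₀ a * z = z * π₀ a} ∩ {a | π₀ a * star z = star z * π₀ a} :=
      Set.ext hCmem
    rw [this]
    have := continuous_rep π₀
    exact (isClosed_eq (by fun_prop) (by fun_prop)).inter (isClosed_eq (by fun_prop) (by fun_prop))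
  have hle : (⨆ F : {F : Finset Bond // (F : Set Bond) ⊆ Λ}, localAlgebra d F.1) ≤
      C.map (regionAlgebra d Set.univ).subtype := by
    refine iSup_le fun F => StarAlgebra.adjoin_le ?_
    rintro _ ⟨b, hb, M, rfl⟩
    refine ⟨bondObservable b M, (hCmem _).2 ⟨hz b (F.2 hb) M, ?_⟩, rfl⟩
    have := (hz b (F.2 hb) M.conjTranspose).star_star
    rwa [← map_star, star_bondObservable, Matrix.conjTranspose_conjTranspose] at this
  have h1 : a ∈ closure (C : Set (QuasiLocal d)) := by
    rw [closure_subtype]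
    exact closure_mono hle ha
  rw [hCclosed.closure_eq] at h1
  exact ((hCmem a).1 h1).1

/-- The bond observables alone generate ℛ(Λ), so commutation need only be tested bond by bond. -/
theorem mem_coneAlgebra_iff {z : H →L[ℂ] H} : z ∈ coneAlgebra π₀ Λ ↔
    ∀ w, (∀ b ∈ Λ, ∀ M, Commute (π₀ (bondObservable b M)) w) → Commute w z := by
  rw [← SetLike.mem_coe, coneAlgebra, coe_doubleCommutant]
  refine ⟨fun hz w hw => hz w ?_, fun h w hw => h w fun b hb M => ?_⟩
  · rintro _ ⟨a, ha, rfl⟩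
    exact rep_commute_of_bondObservable hw ha
  · exact hw _ ⟨bondObservable b M, bondOp_mem_regionAlgebra hb M, rfl⟩

theorem rep_bondObservable_mem {b : Bond} (hb : b ∈ Λ) (M : Matrix (Fin d) (Fin d) ℂ) :
    π₀ (bondObservable b M) ∈ coneAlgebra π₀ Λ :=
  mem_coneAlgebra_iff.2 fun _ hw => (hw b hb M).symm

theorem mem_commutant_coneAlgebra_iff {w : H →L[ℂ] H} : w ∈ (coneAlgebra π₀ Λ).commutant ↔
    ∀ b ∈ Λ, ∀ M, Commute (π₀ (bondObservable b M)) w := by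
  rw [VonNeumannAlgebra.mem_commutant_iff]
  exact ⟨fun h b hb M => h _ (rep_bondObservable_mem hb M),
    fun h z hz => (mem_coneAlgebra_iff.1 hz w h).symm⟩

theorem coneAlgebra_mono (h : Λ ⊆ Λ') : coneAlgebra π₀ Λ ≤ coneAlgebra π₀ Λ' := fun _ hz =>
  mem_coneAlgebra_iff.2 fun w hw => mem_coneAlgebra_iff.1 hz w fun b hb => hw b (h hb)

theorem dualAlgebra_mono (h : Λ ⊆ Λ') : dualAlgebra π₀ Λ ≤ dualAlgebra π₀ Λ' := fun _ hz =>
  mem_commutant_coneAlgebra_iff.2 fun b hb =>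
    mem_commutant_coneAlgebra_iff.1 hz b (Set.compl_subset_compl.2 h hb)

theorem coneAlgebra_le_dualAlgebra : coneAlgebra π₀ Λ ≤ dualAlgebra π₀ Λ := fun _ hz =>
  mem_commutant_coneAlgebra_iff.2 fun b hb M =>
    mem_coneAlgebra_iff.1 hz _ fun b' hb' M' =>
      (bondObservable_commute (b := b') (b' := b) (fun h => hb (h ▸ hb')) M' M).map π₀

theorem commute_of_mem_adjoin_union {A B : StarSubalgebra ℂ (H →L[ℂ] H)} {x : H →L[ℂ] H}
    (hA : ∀ a ∈ A, Commute a x) (hB : ∀ b ∈ B, Commute b x) {s : H →L[ℂ] H}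
    (hs : s ∈ StarAlgebra.adjoin ℂ ((A : Set (H →L[ℂ] H)) ∪ B)) : Commute s x := by
  have h1 : StarAlgebra.adjoin ℂ ((A : Set (H →L[ℂ] H)) ∪ B) ≤ StarSubalgebra.centralizer ℂ {x} := by
    refine StarAlgebra.adjoin_le fun g hg => (StarSubalgebra.mem_centralizer_iff ℂ).2 ?_
    rintro _ rfl
    rcases hg with hg | hg
    · exact ⟨(hA g hg).symm, by simpa using ((hA _ (star_mem hg)).star_star).symm.eq⟩
    · exact ⟨(hB g hg).symm, by simpa using ((hB _ (star_mem hg)).star_star).symm.eq⟩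
  exact (((StarSubalgebra.mem_centralizer_iff ℂ).1 (h1 hs)) x rfl).1.symm

/-- For separated cones `Λ₁'` and `Λ₂'`, the part of `ℛ(Λ₁' ∪ Λ₂')` which commutes with the
observables outside of the smaller cones `Λ₁` and `Λ₂` is `ℛ(Λ₁ ∪ Λ₂)`. -/
theorem mem_coneAlgebra_union_of_commute (hHaag : HaagDuality π₀)
    {ll : Set Bond → Set Bond → Prop} (hsplit : IsDistalSplitRelation π₀ ll)
    {Λ₁ Λ₂ Λ₁' Λ₂' : Set Bond} (hsep : IsSeparatedPair ll Λ₁' Λ₂')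
    (hc₁ : IsCone Λ₁) (hc₂ : IsCone Λ₂) {z : H →L[ℂ] H}
    (hz : z ∈ coneAlgebra π₀ (Λ₁' ∪ Λ₂'))
    (hz₁ : ∀ a ∈ coneAlgebra π₀ (Λ₁' \ Λ₁), Commute a z)
    (hz₂ : ∀ a ∈ coneAlgebra π₀ (Λ₂' \ Λ₂), Commute a z) :
    z ∈ coneAlgebra π₀ (Λ₁ ∪ Λ₂) := by
  obtain ⟨hc₁', hc₂', Δ, hΔ, hll, hdisj⟩ := hsep
  obtain ⟨-, N, hN, hM₁, hNΔ⟩ := hsplit _ _ hc₁' hΔ hll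
  obtain ⟨ω, hω⟩ := hN.exists_isProductVector
  have hM₂ : coneAlgebra π₀ Λ₂' ≤ N.commutant := fun m hm =>
    -- N ⊆ ℛ(Δ) = ℛ(Δᶜ)' by Haag duality, and Λ₂' ⊆ Δᶜ.
    VonNeumannAlgebra.mem_commutant_iff.2 fun n hn => by
      have h1 := hNΔ hn
      rw [hHaag Δ hΔ] at h1
      exact (VonNeumannAlgebra.mem_commutant_iff.1 h1 m (coneAlgebra_mono hdisj hm)).symm
  have hfac' : IsFactor N.commutant := fun x hx hx' =>
    hN.1 x (by rwa [VonNeumannAlgebra.commutant_commutant] at hx') hx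
  -- P is chosen so that P' ∩ N ⊆ ℛ(Λ₁): commuting with ℛ(Λ₁')' ∩ N forces membership in ℛ(Λ₁') by
  -- the relative double commutant, and Haag duality then removes Λ₁' \ Λ₁. Q is the analogue in N'.
  set P := StarAlgebra.adjoin ℂ ((relativeCommutant N (coneAlgebra π₀ Λ₁').toStarSubalgebra :
    Set (H →L[ℂ] H)) ∪ (coneAlgebra π₀ (Λ₁' \ Λ₁)).toStarSubalgebra) with hP
  set Q := StarAlgebra.adjoin ℂ
    ((relativeCommutant N.commutant (coneAlgebra π₀ Λ₂').toStarSubalgebra :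
    Set (H →L[ℂ] H)) ∪ (coneAlgebra π₀ (Λ₂' \ Λ₂)).toStarSubalgebra) with hQ
  have hPN : P ≤ N.toStarSubalgebra := by
    refine StarAlgebra.adjoin_le (Set.union_subset (fun a ha => (mem_relativeCommutant.1 ha).1) ?_)
    exact fun a ha => hM₁ (coneAlgebra_mono Set.sdiff_subset ha)
  have hQN : Q ≤ N.commutant.toStarSubalgebra := by
    refine StarAlgebra.adjoin_le (Set.union_subset (fun a ha => (mem_relativeCommutant.1 ha).1) ?_)
    exact fun a ha => hM₂ (coneAlgebra_mono Set.sdiff_subset ha)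
  have haag_diff : ∀ {Λ Λ' : Set Bond}, IsCone Λ → IsCone Λ' → ∀ {y : H →L[ℂ] H},
      y ∈ coneAlgebra π₀ Λ' → (∀ a ∈ coneAlgebra π₀ (Λ' \ Λ), a * y = y * a) →
      y ∈ coneAlgebra π₀ Λ := by
    intro Λ Λ' hΛ hΛ' y hy hya
    rw [hHaag Λ' hΛ', mem_commutant_coneAlgebra_iff] at hy
    rw [hHaag Λ hΛ, mem_commutant_coneAlgebra_iff]
    intro b hb M
    by_cases hb' : b ∈ Λ'
    · exact hya _ (rep_bondObservable_mem (Λ := Λ' \ Λ) ⟨hb', hb⟩ M)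
    · exact hy b hb' M
  refine mem_coneAlgebra_iff.2 fun w hw => ?_
  have hw₁ : w ∈ (coneAlgebra π₀ Λ₁).commutant :=
    mem_commutant_coneAlgebra_iff.2 fun b hb => hw b (Or.inl hb)
  have hw₂ : w ∈ (coneAlgebra π₀ Λ₂).commutant :=
    mem_commutant_coneAlgebra_iff.2 fun b hb => hw b (Or.inr hb)
  have hcomm : ∀ a ∈ N, ∀ b ∈ N.commutant, Commute a b := fun a ha b hb =>
    VonNeumannAlgebra.mem_commutant_iff.1 hb a ha
  refine (hω.commute hN.1 hPN hQN (fun a ha => ?_) (fun a ha => ?_) (fun a ha => ?_)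
    fun a ha => ?_).symm
  · refine commute_of_mem_adjoin_union (fun c hc => ?_) hz₁ ha
    obtain ⟨hcN, hcM⟩ := mem_relativeCommutant.1 hc
    refine mem_coneAlgebra_iff.1 hz c ?_
    rintro b (hb | hb) M
    · exact hcM _ (rep_bondObservable_mem hb M)
    · exact (hcomm c hcN _ (hM₂ (rep_bondObservable_mem hb M))).symm
  · refine commute_of_mem_adjoin_union (fun c hc => ?_) hz₂ ha
    obtain ⟨hcN, hcM⟩ := mem_relativeCommutant.1 hc
    refine mem_coneAlgebra_iff.1 hz c ?_
    rintro b (hb | hb) M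
    · exact hcomm _ (hM₁ (rep_bondObservable_mem hb M)) c hcN
    · exact hcM _ (rep_bondObservable_mem hb M)
  · obtain ⟨haN, haP⟩ := mem_relativeCommutant.1 ha
    refine VonNeumannAlgebra.mem_commutant_iff.1 hw₁ a (haag_diff hc₁ hc₁' ?_ fun g hg =>
      haP g (StarAlgebra.subset_adjoin ℂ _ (Or.inr hg)))
    exact hω.mem_of_commute_relativeCommutant hN.1 hM₁ haN fun g hg =>
      haP g (StarAlgebra.subset_adjoin ℂ _ (Or.inl hg))
  · obtain ⟨haN, haQ⟩ := mem_relativeCommutant.1 ha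
    refine VonNeumannAlgebra.mem_commutant_iff.1 hw₂ a (haag_diff hc₂ hc₂' ?_ fun g hg =>
      haQ g (StarAlgebra.subset_adjoin ℂ _ (Or.inr hg)))
    exact hω.commutant.mem_of_commute_relativeCommutant hfac' hM₂ haN fun g hg =>
      haQ g (StarAlgebra.subset_adjoin ℂ _ (Or.inl hg))

theorem IsSeparatedPair.disjoint {ll : Set Bond → Set Bond → Prop}
    (hsplit : IsDistalSplitRelation π₀ ll) {Λ₁ Λ₂ : Set Bond} (h : IsSeparatedPair ll Λ₁ Λ₂) :
    Disjoint Λ₁ Λ₂ := by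
  obtain ⟨hc, -, Δ, hΔ, hll, hdisj⟩ := h
  exact Set.disjoint_of_subset_left (hsplit _ _ hc hΔ hll).1
    (Set.disjoint_left.2 fun b hb hb' => hdisj hb' hb)

theorem IsConePair.disjoint {ll : Set Bond → Set Bond → Prop}
    (hsplit : IsDistalSplitRelation π₀ ll) {Γ Λ₁ Λ₂ : Set Bond} (h : IsConePair ll Γ Λ₁ Λ₂) :
    Disjoint Λ₁ Λ₂ :=
  h.2.elim (fun h => h.disjoint hsplit) fun h => (h.disjoint hsplit).symm

theorem IsConePair.isCone {ll : Set Bond → Set Bond → Prop} {Γ Λ₁ Λ₂ : Set Bond}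
    (h : IsConePair ll Γ Λ₁ Λ₂) : IsCone Λ₁ ∧ IsCone Λ₂ :=
  h.2.elim (fun h => ⟨h.1, h.2.1⟩) fun h => ⟨h.2.1, h.1⟩

end Net

section Restriction

variable {H : Type*} [NormedAddCommGroup H] [InnerProductSpace ℂ H] [CompleteSpace H]
  {M N M' N' : VonNeumannAlgebra H}

/-! ### Restriction of conditional expectations -/

/-- Apply E to a x = x a and use bimodularity on each side. -/
theorem IsNormalCondExp.commute_apply {E : M.toStarSubalgebra →ₗ[ℂ] N.toStarSubalgebra}
    (hE : IsNormalCondExp M N E) {a : H →L[ℂ] H} (ha : a ∈ N) (x : M.toStarSubalgebra)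
    (hax : Commute a (x : H →L[ℂ] H)) : Commute a (E x : H →L[ℂ] H) := by
  have h1 := hE.bimodule ⟨a, hE.le ha⟩ x 1 ha (one_mem N)
  have h2 := hE.bimodule 1 x ⟨a, hE.le ha⟩ (one_mem N) ha
  have h3 : (⟨a, hE.le ha⟩ : M.toStarSubalgebra) * x * 1 = 1 * x * ⟨a, hE.le ha⟩ := by
    rw [mul_one, one_mul]
    exact Subtype.ext hax.eq
  rw [h3, h2] at h1
  change (1 : H →L[ℂ] H) * (E x : H →L[ℂ] H) * a = a * (E x : H →L[ℂ] H) * 1 at h1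
  rw [one_mul, mul_one] at h1
  exact h1.symm

/-- The restriction of a linear map `E : M' → N'` to `M ⊆ M'`, with values in `N`. -/
def restrictLinearMap (hM : M ≤ M') (E : M'.toStarSubalgebra →ₗ[ℂ] N'.toStarSubalgebra)
    (hmem : ∀ x : M.toStarSubalgebra, (E ⟨x, hM x.2⟩ : H →L[ℂ] H) ∈ N) :
    M.toStarSubalgebra →ₗ[ℂ] N.toStarSubalgebra where
  toFun x := ⟨E ⟨x, hM x.2⟩, hmem x⟩
  map_add' x y := Subtype.ext (by
    have := congrArg Subtype.val (map_add E ⟨x, hM x.2⟩ ⟨y, hM y.2⟩)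
    exact this)
  map_smul' k x := Subtype.ext (by
    have := congrArg Subtype.val (map_smul E k ⟨x, hM x.2⟩)
    exact this)

theorem IsNormalCondExp.restrict {E : M'.toStarSubalgebra →ₗ[ℂ] N'.toStarSubalgebra}
    (hE : IsNormalCondExp M' N' E) (hM : M ≤ M') (hN : N ≤ N') (hNM : N ≤ M)
    (hmem : ∀ x : M.toStarSubalgebra, (E ⟨x, hM x.2⟩ : H →L[ℂ] H) ∈ N) :
    IsNormalCondExp M N (restrictLinearMap hM E hmem) := by
  refine ⟨hNM, fun x hx => hE.apply_of_mem ⟨x, hM x.2⟩ (hN hx),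
    fun a x b ha hb => hE.bimodule ⟨a, hM a.2⟩ ⟨x, hM x.2⟩ ⟨b, hM b.2⟩ (hN ha) (hN hb),
    fun x hx => hE.nonneg ⟨x, hM x.2⟩ hx, fun D hD hdir hpos x hx => ?_⟩
  -- Normality passes to M because the suprema are taken among all operators and do not depend on
  -- the algebra.
  set ι : M.toStarSubalgebra → M'.toStarSubalgebra := fun x => ⟨x, hM x.2⟩
  have := hE.normal (ι '' D) (hD.image ι) ?_ ?_ (ι x) ?_
  · rwa [Set.image_image] at this
  · rintro _ ⟨y, hy, rfl⟩ _ ⟨z, hz, rfl⟩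
    obtain ⟨w, hw, h1, h2⟩ := hdir y hy z hz
    exact ⟨ι w, ⟨w, hw, rfl⟩, h1, h2⟩
  · rintro _ ⟨y, hy, rfl⟩
    exact hpos y hy
  · rwa [Set.image_image]

/-- The index of an inclusion `N ⊆ M` is at most that of a larger inclusion `N' ⊆ M'` whose
conditional expectations map `M` into `N`. -/
theorem kosakiLongoIndex_le_of_maps (hM : M ≤ M') (hN : N ≤ N') (hNM : N ≤ M)
    (hmem : ∀ E : M'.toStarSubalgebra →ₗ[ℂ] N'.toStarSubalgebra, IsNormalCondExp M' N' E →
      ∀ x : M'.toStarSubalgebra, (x : H →L[ℂ] H) ∈ M → (E x : H →L[ℂ] H) ∈ N) :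
    kosakiLongoIndex M N ≤ kosakiLongoIndex M' N' := by
  refine sInf_le_sInf ?_
  rintro r ⟨E, hE, c, hc, hbound, rfl⟩
  exact ⟨_, hE.restrict hM hN hNM fun x => hmem E hE _ x.2, c, hc,
    fun x hx => hbound ⟨x, hM x.2⟩ hx, rfl⟩

end Restriction

end SpinModel

end

theorem mainTheorem5 (d : ℕ) [NeZero d]
    {H : Type*} [NormedAddCommGroup H] [InnerProductSpace ℂ H] [CompleteSpace H]
    (π₀ : SpinModel.QuasiLocal d →⋆ₐ[ℂ] (H →L[ℂ] H))
    (hirr : SpinModel.IsIrreducibleRep π₀)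
    (hHaag : SpinModel.HaagDuality π₀)
    (ll : Set SpinModel.Bond → Set SpinModel.Bond → Prop)
    (hsplit : SpinModel.IsDistalSplitRelation π₀ ll)
    (Γ Γ' Λ₁ Λ₂ Λ₁' Λ₂' : Set SpinModel.Bond)
    (hΓ : SpinModel.IsConePair ll Γ Λ₁ Λ₂)
    (hΓ' : SpinModel.IsConePair ll Γ' Λ₁' Λ₂')
    (h₁ : Λ₁ ⊆ Λ₁') (h₂ : Λ₂ ⊆ Λ₂') :
    SpinModel.kosakiLongoIndex (SpinModel.dualAlgebra π₀ Γ) (SpinModel.coneAlgebra π₀ Γ) ≤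
      SpinModel.kosakiLongoIndex (SpinModel.dualAlgebra π₀ Γ') (SpinModel.coneAlgebra π₀ Γ') := by
  open SpinModel in
  have hsub : Γ ⊆ Γ' := by
    rw [hΓ.1, hΓ'.1]
    exact Set.union_subset_union h₁ h₂
  have hdisj := hΓ'.disjoint hsplit
  -- Disjointness of Λ₁' and Λ₂' keeps Λ₁' \ Λ₁ away from Λ₂.
  have hout₁ : Λ₁' \ Λ₁ ⊆ Γᶜ := fun b hb hbΓ => by
    rw [hΓ.1] at hbΓ
    exact hbΓ.elim hb.2 fun hb' => Set.disjoint_left.1 hdisj hb.1 (h₂ hb')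
  have hout₂ : Λ₂' \ Λ₂ ⊆ Γᶜ := fun b hb hbΓ => by
    rw [hΓ.1] at hbΓ
    exact hbΓ.elim (fun hb' => Set.disjoint_left.1 hdisj (h₁ hb') hb.1) hb.2
  have hin₁ : Λ₁' \ Λ₁ ⊆ Γ' := by
    rw [hΓ'.1]
    exact Set.sdiff_subset.trans Set.subset_union_left
  have hin₂ : Λ₂' \ Λ₂ ⊆ Γ' := by
    rw [hΓ'.1]
    exact Set.sdiff_subset.trans Set.subset_union_right
  have hred : ∀ z ∈ coneAlgebra π₀ Γ', (∀ a ∈ coneAlgebra π₀ (Λ₁' \ Λ₁), Commute a z) →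
      (∀ a ∈ coneAlgebra π₀ (Λ₂' \ Λ₂), Commute a z) → z ∈ coneAlgebra π₀ Γ := by
    intro z hz hz₁ hz₂
    rw [hΓ'.1] at hz
    rw [hΓ.1]
    rcases hΓ'.2 with hsep | hsep
    · exact mem_coneAlgebra_union_of_commute hHaag hsplit hsep hΓ.isCone.1 hΓ.isCone.2
        hz hz₁ hz₂
    · rw [Set.union_comm] at hz ⊢
      exact mem_coneAlgebra_union_of_commute hHaag hsplit hsep hΓ.isCone.2 hΓ.isCone.1
        hz hz₂ hz₁
  refine kosakiLongoIndex_le_of_maps (dualAlgebra_mono hsub) (coneAlgebra_mono hsub)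
    coneAlgebra_le_dualAlgebra fun E hE x hx => ?_
  -- Δ ⊆ Γᶜ makes ℛ(Δ) commute with x, and Δ ⊆ Γ' lets it pass through E.
  have hcommE : ∀ Δ : Set Bond, Δ ⊆ Γᶜ → Δ ⊆ Γ' → ∀ a ∈ coneAlgebra π₀ Δ,
      Commute a (E x : H →L[ℂ] H) := fun Δ hΔ hΔ' a ha =>
    hE.commute_apply (coneAlgebra_mono hΔ' ha) x
      (VonNeumannAlgebra.mem_commutant_iff.1 hx a (coneAlgebra_mono hΔ ha))
  exact hred _ (E x).2 (hcommE _ hout₁ hin₁) (hcommE _ hout₂ hin₂)
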